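/- Let $X$ be a Fano manifold of dimension $n$, i.e. a (non-empty) compact complex manifold whose anti-canonical line bundle $-K_X=\Lambda^nTX$ admits a smooth metric with positive curvature. Line bundles and metrics are written additively: a metric $\phi$ on $-K_X$ is given by local weights, also denoted $\phi$, such that $|s|_\phi^2=|s|^2e^{-\phi}$ in a local trivialization, and $k\phi$ denotes the induced metric on $-kK_X$. A smooth metric $\phi$ on $-K_X$ induces a volume form $e^{-\phi}$ on $X$, whose density with respect to Lebesgue measure in local holomorphic coordinates $z_1,\dots,z_n$ is $e^{-\phi}$, where $\phi$ is the weight with respect to $\partial/\partial z_1\wedge\cdots\wedge\partial/\partial z_n$. Let $\mathcal H$ be the space of smooth metrics on $-K_X$ with positive curvature. Let $k\ge 1$ be an integer such that $-kK_X$ is globally generated (so that the Fubini–Study metrics below are smooth metrics), let $N:=\dim H^0(X,-kK_X)$, and let $\mathcal H_k$ be the space of all Hermitian metrics (positive definite Hermitian inner products) on the complex vector space $H^0(X,-kK_X)$. For a smooth metric $\phi$ on $-K_X$ and a volume form $\mu$ on $X$ let $H^{(k)}(\phi,\mu)\in\mathcal H_k$ be defined by $H^{(k)}(\phi,\mu)(s,s):=\int_X|s|^2_{k\phi}\,\mu$.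 For $H\in\mathcal H_k$ let $$FS(H):=k^{-1}\log\Big(\frac1N\sum_{i=1}^N|s_i^H|^2\Big),$$ a smooth metric on $-K_X$, where $(s^H_i)$ is any basis of $H^0(X,-kK_X)$ that is orthonormal with respect to $H$. Fix $\psi_0\in\mathcal H$ and a basis of $H^0(X,-kK_X)$ that is orthonormal with respect to $H^{(k)}(\psi_0,e^{-\psi_0})$; determinants of Hermitian forms on $H^0(X,-kK_X)$ are taken with respect to this basis. Fix $\gamma>0$ and a smooth metric $\phi_0$ on $-K_X$. For a smooth metric $\phi$ on $-K_X$ put $$\mathcal D_{k,-\gamma}(\phi):=\frac{1}{N(k+\gamma)}\log\det H^{(k)}\big(\phi,e^{-(\gamma\phi+(1-\gamma)\phi_0)}\big)-\frac1\gamma\log\int_Xe^{-(\gamma\phi+(1-\gamma)\phi_0)},$$ and for $H\in\mathcal H_k$ put $$D_{k,-\gamma}(H):=\frac1{kN}\log\det H-\frac1\gamma\log\int_Xe^{-(\gamma FS(H)+(1-\gamma)\phi_0)}.$$ Then for any smooth metric $\phi$ on $-K_X$ $$D_{k,-\gamma}\big(H^{(k)}(\phi,e^{-(\gamma\phi+(1-\gamma)\phi_0)})\big)\le\Big(1+\frac\gamma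 k\Big)\mathcal D_{k,-\gamma}(\phi),$$ and for any $H\in\mathcal H_k$ $$\Big(1+\frac\gamma k\Big)\mathcal D_{k,-\gamma}(FS(H))\le D_{k,-\gamma}(H).$$ In particular, $$\inf_{\mathcal H_k}D_{k,-\gamma}=\Big(1+\frac\gamma k\Big)\inf_{\mathcal H}\mathcal D_{k,-\gamma}$$ as an identity in $[-\infty,\infty)$. -/

import Mathlib

open scoped Manifold ContDiff Bundle

noncomputable section

namespace AntiCanonical

/-- The model space `ℂⁿ` (its `volume` is Lebesgue measure on `ℂⁿ = ℝ²ⁿ`). -/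
abbrev Model (n : ℕ) : Type := Fin n → ℂ

section Bundle

variable (n : ℕ) (X : Type*) [TopologicalSpace X] [ChartedSpace (Model n) X]
  [IsManifold 𝓘(ℂ, Model n) ω X]

/-- For charts `i, j` of the complex manifold `X`, the complex Jacobian determinant
`det (∂ z_j / ∂ z_i)` at `x`, i.e. the transition function of the top exterior power
`-K_X = Λⁿ TX` from the frame `∂/∂z_i¹ ∧ ⋯ ∧ ∂/∂z_iⁿ` to the frame of the chart `j`. -/
def jacobian (i j : atlas (Model n) X) (x : X) : ℂ :=
  ((tangentBundleCore 𝓘(ℂ, Model n) X).coordChange i j x).det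

/-- The holomorphic line bundle `-k K_X`, the `k`-th tensor power of `Λⁿ TX`, given by its
transition functions `det (∂ z_j / ∂ z_i) ^ k`. -/
def antiCore (k : ℕ) : VectorBundleCore ℂ X ℂ (atlas (Model n) X) where
  baseSet i := i.1.source
  isOpen_baseSet i := i.1.open_source
  indexAt := achart (Model n)
  mem_baseSet_at x := mem_chart_source (Model n) x
  coordChange i j x := (jacobian n X i j x ^ k) • ContinuousLinearMap.id ℂ ℂ
  coordChange_self i x hx v := by
    have h : (tangentBundleCore 𝓘(ℂ, Model n) X).coordChange i i x
        = ContinuousLinearMap.id ℂ (Model n) := by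
      ext1 w
      exact (tangentBundleCore 𝓘(ℂ, Model n) X).coordChange_self i x hx w
    have hdet : jacobian n X i i x = 1 := by
      unfold jacobian
      rw [h]
      simp [ContinuousLinearMap.det]
    simp [hdet]
  continuousOn_coordChange i j := by
    have h := (tangentBundleCore 𝓘(ℂ, Model n) X).continuousOn_coordChange i j
    exact ((ContinuousLinearMap.continuous_det.comp_continuousOn h).pow k).smul
      continuousOn_const
  coordChange_comp i j l x hx v := by
    have h : ((tangentBundleCore 𝓘(ℂ, Model n) X).coordChange j l x).comp
        ((tangentBundleCore 𝓘(ℂ, Model n) X).coordChange i j x)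
        = (tangentBundleCore 𝓘(ℂ, Model n) X).coordChange i l x := by
      ext1 w
      exact (tangentBundleCore 𝓘(ℂ, Model n) X).coordChange_comp i j l x hx w
    have hdet : jacobian n X j l x * jacobian n X i j x = jacobian n X i l x := by
      unfold jacobian
      rw [← h]
      simp [ContinuousLinearMap.det]
    simp [← hdet, mul_pow, mul_assoc]

/-- `H⁰(X, -k K_X)`, the complex vector space of global holomorphic sections of `-k K_X`. -/
abbrev Sections (k : ℕ) : Type _ :=
  ContMDiffSection 𝓘(ℂ, Model n) ℂ ω (antiCore n X k).Fiber

/-- `N = dim H⁰(X, -k K_X)`. -/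
def dimSections (k : ℕ) : ℕ := Module.finrank ℂ (Sections n X k)

end Bundle

variable {n : ℕ} {X : Type*} [TopologicalSpace X] [ChartedSpace (Model n) X]
  [IsManifold 𝓘(ℂ, Model n) ω X]

/-- The value of a section at `x`, as a complex number, in the frame of the preferred chart
`chartAt x` (this is how the fibre of a `VectorBundleCore` at `x` is identified with `ℂ`). -/
def value {k : ℕ} (s : Sections n X k) (x : X) : ℂ := s x

/-- `-k K_X` is globally generated (base point free): at every point some global holomorphic
section does not vanish. -/
def GloballyGenerated (n : ℕ) (X : Type*) [TopologicalSpace X] [ChartedSpace (Model n) X]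
    [IsManifold 𝓘(ℂ, Model n) ω X] (k : ℕ) : Prop :=
  ∀ x : X, ∃ s : Sections n X k, value s x ≠ 0

/-! A (not necessarily smooth) metric `φ` on `-K_X` is encoded by the real function
`φ : X → ℝ` such that the squared norm of a vector `v` in the fibre of `-K_X` at `x` is
`|v|² exp (-φ x)`, where `v` is read in the frame of the preferred chart at `x`.
Then `|v|² exp (-k φ x)` is the induced metric `k φ` on `-k K_X`. Affine combinations of metrics
are pointwise affine combinations of such functions. -/

/-- The local weight of the metric `φ` in the chart `e`, i.e. the function `φ_e` on the domain
of `e` such that the squared norm of the frame `∂/∂z¹ ∧ ⋯ ∧ ∂/∂zⁿ` of the chart is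
`exp (-φ_e)`. -/
def localWeight (φ : X → ℝ) (e : atlas (Model n) X) (x : X) : ℝ :=
  φ x + Real.log (‖jacobian n X (achart (Model n) x) e x‖ ^ 2)

/-- The local weight as a function on the open subset `e.target` of `ℂⁿ`. -/
def weightInChart (φ : X → ℝ) (e : atlas (Model n) X) (z : Model n) : ℝ :=
  localWeight φ e (e.1.symm z)

/-- The metric is smooth: its local weights are smooth functions. -/
def IsSmoothMetric (n : ℕ) {X : Type*} [TopologicalSpace X] [ChartedSpace (Model n) X]
    [IsManifold 𝓘(ℂ, Model n) ω X] (φ : X → ℝ) : Prop :=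
  ∀ e : atlas (Model n) X, ContDiffOn ℝ ∞ (weightInChart φ e) e.1.target

/-- The Levi form `∑ (∂²u/∂z_i∂z̄_j) v_i v̄_j = (D²u(v,v) + D²u(iv,iv)) / 4`
of a function `u` at `z`, with `D²u` the real Hessian. -/
def leviForm (u : Model n → ℝ) (z v : Model n) : ℝ :=
  (fderiv ℝ (fderiv ℝ u) z v v
    + fderiv ℝ (fderiv ℝ u) z (Complex.I • v) (Complex.I • v)) / 4

/-- `φ ∈ 𝓗`: a smooth metric on `-K_X` with positive curvature, i.e. the complex Hessians of
its local weights are positive definite. -/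
def IsPositiveMetric (n : ℕ) {X : Type*} [TopologicalSpace X] [ChartedSpace (Model n) X]
    [IsManifold 𝓘(ℂ, Model n) ω X] (φ : X → ℝ) : Prop :=
  IsSmoothMetric n φ ∧ ∀ e : atlas (Model n) X, ∀ z ∈ e.1.target, ∀ v : Model n, v ≠ 0 →
    0 < leviForm (weightInChart φ e) z v

section Measure

variable [MeasurableSpace X]

/-- The volume form `e^{-φ}` on `X` induced by a metric `φ` on `-K_X`: in each chart `e` it has
density `exp (-φ_e)` with respect to Lebesgue measure. The local measures are the restrictions
of one measure to the chart domains, and the latter is recovered as their supremum. -/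
def volForm (n : ℕ) {X : Type*} [TopologicalSpace X] [ChartedSpace (Model n) X]
    [IsManifold 𝓘(ℂ, Model n) ω X] [MeasurableSpace X] (φ : X → ℝ) : MeasureTheory.Measure X :=
  ⨆ e : atlas (Model n) X, MeasureTheory.Measure.map e.1.symm
    ((MeasureTheory.volume.restrict e.1.target).withDensity
      fun z => ENNReal.ofReal (Real.exp (-weightInChart φ e z)))

/-- The volume form `e^{-(γ φ + (1 - γ) φ₀)}`. -/
def twistedVol (n : ℕ) {X : Type*} [TopologicalSpace X] [ChartedSpace (Model n) X]
    [IsManifold 𝓘(ℂ, Model n) ω X] [MeasurableSpace X] (γ : ℝ) (φ₀ φ : X → ℝ) :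
    MeasureTheory.Measure X :=
  volForm n fun x => γ * φ x + (1 - γ) * φ₀ x

/-- The `L²` Hermitian form `H^{(k)}(φ, μ)` on `H⁰(X, -k K_X)`: its value at `(s, t)` is the
integral of the pointwise product `⟨s, t⟩_{kφ}` (conjugate linear in `s`) against `μ`. -/
def hilbForm (k : ℕ) (φ : X → ℝ) (μ : MeasureTheory.Measure X) (s t : Sections n X k) : ℂ :=
  ∫ x, (starRingEnd ℂ (value s x) * value t x) * (Real.exp (-(k * φ x)) : ℂ) ∂μ

/-- `H_k`: the set of Hermitian metrics (positive definite Hermitian inner products) on the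
complex vector space `H⁰(X, -k K_X)`. -/
abbrev HermMetric (n : ℕ) (X : Type*) [TopologicalSpace X] [ChartedSpace (Model n) X]
    [IsManifold 𝓘(ℂ, Model n) ω X] (k : ℕ) : Type _ :=
  InnerProductSpace.Core ℂ (Sections n X k)

/-- `log det` of the matrix of a Hermitian form in the basis `b`. -/
def logDet {k : ℕ} (b : Module.Basis (Fin (dimSections n X k)) ℂ (Sections n X k))
    (B : Sections n X k → Sections n X k → ℂ) : ℝ :=
  Real.log (Matrix.det (Matrix.of fun i j => B (b i) (b j))).re

/-- A family of `N = dim H⁰(X, -k K_X)` sections (hence a basis) orthonormal with respect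
to `H`. -/
def orthonormalBasis {k : ℕ} (H : HermMetric n X k) : Fin (dimSections n X k) → Sections n X k :=
  Classical.epsilon fun s => ∀ i j, H.inner (s i) (s j) = if i = j then 1 else 0

/-- The Fubini-Study metric `FS(H) = k⁻¹ log (N⁻¹ ∑ |s_i|²)` on `-K_X`, with `(s_i)` any
basis of `H⁰(X, -k K_X)` orthonormal for `H`. -/
def fubiniStudy {k : ℕ} (H : HermMetric n X k) (x : X) : ℝ :=
  (k : ℝ)⁻¹ * Real.log ((dimSections n X k : ℝ)⁻¹ * ∑ i, ‖value (orthonormalBasis H i) x‖ ^ 2)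

/-- `𝓛_k(φ) = -(1 / (N (k + γ))) log det H^{(k)}(φ, e^{-(γ φ + (1 - γ) φ₀)})`. -/
def calL {k : ℕ} (b : Module.Basis (Fin (dimSections n X k)) ℂ (Sections n X k))
    (γ : ℝ) (φ₀ φ : X → ℝ) : ℝ :=
  -(1 / (dimSections n X k * (k + γ))) * logDet b (hilbForm k φ (twistedVol n γ φ₀ φ))

/-- The functional `𝓓_{k,-γ}(φ) = -𝓛_k(φ) - γ⁻¹ log ∫ e^{-(γ φ + (1 - γ) φ₀)}` on metrics. -/
def dingMetric {k : ℕ} (b : Module.Basis (Fin (dimSections n X k)) ℂ (Sections n X k))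
    (γ : ℝ) (φ₀ φ : X → ℝ) : ℝ :=
  -calL b γ φ₀ φ - (1 / γ) * Real.log ((twistedVol n γ φ₀ φ).real Set.univ)

/-- The quantized Ding functional
`D_{k,-γ}(H) = (1 / (k N)) log det H - γ⁻¹ log ∫ e^{-(γ FS(H) + (1 - γ) φ₀)}` on `H_k`. -/
def dingQuantized {k : ℕ} (b : Module.Basis (Fin (dimSections n X k)) ℂ (Sections n X k))
    (γ : ℝ) (φ₀ : X → ℝ) (H : HermMetric n X k) : ℝ :=
  1 / (k * dimSections n X k) * logDet b H.inner
    - (1 / γ) * Real.log ((twistedVol n γ φ₀ (fubiniStudy H)).real Set.univ)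

end Measure

end AntiCanonical

end

/-!
Both comparisons come down to one inequality each, once `e^{-(γφ + (1-γ)φ₀)}` is known to be a
finite measure which charges open sets and changes by the density `e^{-γh}` when `φ` is replaced
by `φ + h`. That is the content of `volForm_apply_of_subset` and `volForm_add`: by the change of
variables formula the local measures agree on overlaps of charts, because the real Jacobian of a
holomorphic map is the squared modulus of the complex one. Functions attached to metrics and
sections are read in the preferred charts, hence need not be continuous; the combinations which
occur (`φ - ψ`, `conj s · t · e^{-kφ}`) are, since the Jacobians cancel.

*First comparison* (`dingQuantized_le`). Let `H` be the `L²` inner product of `φ` with respect to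
`μ = e^{-(γφ + (1-γ)φ₀)}`, and `h = FS(H) - φ`. Since `e^{kh} = N⁻¹ ∑ |s_i|²_{kφ}` for an
`H`-orthonormal basis, `∫ e^{kh} dμ = 1`, and the claim is
`(1 + γ/k) log μ(X) ≤ log ∫ e^{-γh} dμ`, a consequence of convexity
(`log_measure_le_log_integral_exp`).

*Second comparison* (`dingMetric_fubiniStudy_le`). If `φ = FS(H)`, then `∑ |s_i|²_{kφ} = N`, so the
matrix of the `L²` inner product in an `H`-orthonormal basis has trace `N μ(X)`. The
arithmetic-geometric mean inequality for its eigenvalues (`log_det_le`) bounds its determinant by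
`μ(X)^N`.

*Infima.* One inequality follows from the first comparison. For the other one, `FS(H)` is only
semipositively curved (`leviForm_logSum_nonneg`), so it is replaced by `FS(H) + t (ψ₀ - FS(H))`,
which is positive for `0 < t ≤ 1`; as `t → 0` the Ding functional converges
(`continuousAt_dingMetric`).
-/

namespace AntiCanonical

/-! ### The cocycle of `-K_X` and local frames -/

section Cocycle

lemma isOpen_overlap {n : ℕ} {X : Type*} [TopologicalSpace X] [ChartedSpace (Model n) X]
    (i j : atlas (Model n) X) :
    IsOpen (i.1.target ∩ i.1.symm ⁻¹' j.1.source) :=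
  i.1.isOpen_inter_preimage_symm j.1.open_source

lemma continuousOn_of_chart {n : ℕ} {X Y : Type*} [TopologicalSpace X] [TopologicalSpace Y]
    {f : X → Y} {e : OpenPartialHomeomorph X (Model n)}
    (h : ContinuousOn (f ∘ e.symm) e.target) : ContinuousOn f e.source :=
  (h.comp e.continuousOn e.mapsTo).congr fun x hx => by simp [e.left_inv hx]

lemma continuous_of_forall_chart {n : ℕ} {X Y : Type*} [TopologicalSpace X]
    [ChartedSpace (Model n) X] [TopologicalSpace Y] {f : X → Y}
    (h : ∀ e : atlas (Model n) X, ContinuousOn f e.1.source) : Continuous f :=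
  continuous_iff_continuousAt.2 fun x =>
    (h (achart (Model n) x)).continuousAt
      ((achart (Model n) x).1.open_source.mem_nhds (mem_chart_source _ x))

variable {n : ℕ} {X : Type*} [TopologicalSpace X] [ChartedSpace (Model n) X]
  [IsManifold 𝓘(ℂ, Model n) ω X]

lemma jacobian_mul {i j l : atlas (Model n) X} {x : X} (hi : x ∈ i.1.source)
    (hj : x ∈ j.1.source) (hl : x ∈ l.1.source) :
    jacobian n X j l x * jacobian n X i j x = jacobian n X i l x := by
  have h : ((tangentBundleCore 𝓘(ℂ, Model n) X).coordChange j l x).comp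
      ((tangentBundleCore 𝓘(ℂ, Model n) X).coordChange i j x)
      = (tangentBundleCore 𝓘(ℂ, Model n) X).coordChange i l x := by
    ext1 w
    exact (tangentBundleCore 𝓘(ℂ, Model n) X).coordChange_comp i j l x ⟨⟨hi, hj⟩, hl⟩ w
  unfold jacobian
  rw [← h]
  simp [ContinuousLinearMap.det]

lemma jacobian_self {i : atlas (Model n) X} {x : X} (hi : x ∈ i.1.source) :
    jacobian n X i i x = 1 := by
  have h : (tangentBundleCore 𝓘(ℂ, Model n) X).coordChange i i x
      = ContinuousLinearMap.id ℂ (Model n) := by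
    ext1 w
    exact (tangentBundleCore 𝓘(ℂ, Model n) X).coordChange_self i x hi w
  unfold jacobian
  rw [h]
  simp [ContinuousLinearMap.det]

lemma jacobian_mul_symm {i j : atlas (Model n) X} {x : X} (hi : x ∈ i.1.source)
    (hj : x ∈ j.1.source) : jacobian n X j i x * jacobian n X i j x = 1 := by
  rw [jacobian_mul hi hj hi, jacobian_self hi]

lemma jacobian_ne_zero {i j : atlas (Model n) X} {x : X} (hi : x ∈ i.1.source)
    (hj : x ∈ j.1.source) : jacobian n X i j x ≠ 0 :=
  right_ne_zero_of_mul_eq_one (jacobian_mul_symm hi hj)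

lemma norm_jacobian_pos {e : atlas (Model n) X} {x : X} (hx : x ∈ e.1.source) :
    0 < ‖jacobian n X (achart (Model n) x) e x‖ :=
  norm_pos_iff.2 (jacobian_ne_zero (i := achart (Model n) x) (mem_chart_source _ x) hx)

lemma contDiffOn_transition (i j : atlas (Model n) X) :
    ContDiffOn ℂ ω (j.1 ∘ i.1.symm) (i.1.target ∩ i.1.symm ⁻¹' j.1.source) := by
  have h := 𝓘(ℂ, Model n).contDiffOn_extendCoordChange (n := ω)
    (IsManifold.subset_maximalAtlas i.2) (IsManifold.subset_maximalAtlas j.2)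
  simpa [ModelWithCorners.extendCoordChange_source, ModelWithCorners.extendCoordChange] using h

/-- The cocycle defining the tangent bundle is the derivative of the change of charts. -/
lemma coordChange_eq_fderiv (i j : atlas (Model n) X) {z : Model n} (hz : z ∈ i.1.target) :
    (tangentBundleCore 𝓘(ℂ, Model n) X).coordChange i j (i.1.symm z)
      = fderiv ℂ (j.1 ∘ i.1.symm) z := by
  rw [tangentBundleCore_coordChange]
  simp [i.1.right_inv hz]

lemma contDiffOn_jacobian (i j : atlas (Model n) X) :
    ContDiffOn ℂ ω (jacobian n X i j ∘ i.1.symm) (i.1.target ∩ i.1.symm ⁻¹' j.1.source) := by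
  have h1 : ContDiffOn ℂ ω (fun z => fderiv ℂ (j.1 ∘ i.1.symm) z)
      (i.1.target ∩ i.1.symm ⁻¹' j.1.source) :=
    (contDiffOn_transition i j).fderiv_of_isOpen (isOpen_overlap i j) (by simp)
  have h2 : ContDiffOn ℂ ω
      (fun z => Matrix.det (LinearMap.toMatrix'
        (fderiv ℂ (j.1 ∘ i.1.symm) z : Model n →ₗ[ℂ] Model n)))
      (i.1.target ∩ i.1.symm ⁻¹' j.1.source) := by
    simp only [Matrix.det_apply, LinearMap.toMatrix'_apply]
    refine ContDiffOn.sum fun σ _ => ContDiffOn.const_smul _ (contDiffOn_prod fun a _ => ?_)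
    exact contDiffOn_pi.1 (h1.clm_apply contDiffOn_const) _
  refine h2.congr fun z hz => ?_
  simp only [Function.comp_apply, jacobian, coordChange_eq_fderiv i j hz.1]
  rw [LinearMap.det_toMatrix', ContinuousLinearMap.det]

/-- The Jacobian is also holomorphic in the coordinates of the second chart, being the inverse of
the Jacobian of the opposite change of charts. -/
lemma contDiffOn_jacobian_left (i j : atlas (Model n) X) :
    ContDiffOn ℂ ω (jacobian n X i j ∘ j.1.symm) (j.1.target ∩ j.1.symm ⁻¹' i.1.source) := by
  refine ((contDiffOn_jacobian j i).inv fun z hz =>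
    jacobian_ne_zero (j.1.map_target hz.1) hz.2).congr fun z hz => ?_
  exact eq_inv_of_mul_eq_one_left (jacobian_mul_symm (j.1.map_target hz.1) hz.2)

/-- The coordinate of a section of `-k K_X` in the frame of the chart `e`. It is meaningful on the
domain of `e` only. -/
noncomputable def localSection {k : ℕ} (s : Sections n X k) (e : atlas (Model n) X) (x : X) : ℂ :=
  jacobian n X (achart (Model n) x) e x ^ k * value s x

lemma localSection_eq {k : ℕ} (s : Sections n X k) {e e' : atlas (Model n) X} {x : X}
    (he : x ∈ e.1.source) (he' : x ∈ e'.1.source) :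
    localSection s e' x = jacobian n X e e' x ^ k * localSection s e x := by
  unfold localSection
  rw [← mul_assoc, ← mul_pow, jacobian_mul (mem_chart_source _ x) he he']

lemma contMDiffAt_localSection {k : ℕ} (s : Sections n X k) (x₀ : X) :
    ContMDiffAt 𝓘(ℂ, Model n) 𝓘(ℂ, ℂ) ω (localSection s (achart (Model n) x₀)) x₀ :=
  (Bundle.contMDiffAt_section x₀).1 (s.contMDiff x₀)

/-- Holomorphic sections of `-k K_X` have holomorphic coordinates in every chart. -/
lemma contDiffOn_localSection {k : ℕ} (s : Sections n X k) (e : atlas (Model n) X) :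
    ContDiffOn ℂ ω (localSection s e ∘ e.1.symm) e.1.target := by
  intro z hz
  apply ContDiffAt.contDiffWithinAt
  set x₀ := e.1.symm z with hx₀
  have hsrc : x₀ ∈ e.1.source := e.1.map_target hz
  have hc : x₀ ∈ (achart (Model n) x₀).1.source := mem_chart_source _ x₀
  have h1 : ContDiffAt ℂ ω (localSection s (achart (Model n) x₀) ∘ e.1.symm) z := by
    rw [← contMDiffAt_iff_contDiffAt]
    refine ContMDiffAt.comp z (contMDiffAt_localSection s x₀) ?_
    exact (contMDiffOn_symm_of_mem_maximalAtlas (IsManifold.subset_maximalAtlas e.2)).contMDiffAt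
      (e.1.open_target.mem_nhds hz)
  have h2 : ContDiffAt ℂ ω (jacobian n X (achart (Model n) x₀) e ∘ e.1.symm) z :=
    (contDiffOn_jacobian_left (achart (Model n) x₀) e).contDiffAt
      ((isOpen_overlap _ _).mem_nhds ⟨hz, hc⟩)
  refine ((h2.pow k).mul h1).congr_of_eventuallyEq ?_
  filter_upwards [(isOpen_overlap e (achart (Model n) x₀)).mem_nhds ⟨hz, hc⟩] with w hw
  exact localSection_eq s hw.2 (e.1.map_target hw.1)

lemma continuousOn_localSection {k : ℕ} (s : Sections n X k) (e : atlas (Model n) X) :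
    ContinuousOn (localSection s e) e.1.source :=
  continuousOn_of_chart (contDiffOn_localSection s e).continuousOn

lemma continuousOn_localWeight {φ : X → ℝ} (hφ : IsSmoothMetric n φ) (e : atlas (Model n) X) :
    ContinuousOn (localWeight φ e) e.1.source :=
  continuousOn_of_chart (hφ e).continuousOn

lemma continuous_sub_of_smooth {φ ψ : X → ℝ} (hφ : IsSmoothMetric n φ)
    (hψ : IsSmoothMetric n ψ) : Continuous fun x => φ x - ψ x := by
  refine continuous_of_forall_chart (n := n) fun e => ?_
  refine ((continuousOn_localWeight hφ e).sub (continuousOn_localWeight hψ e)).congr fun x _ => ?_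
  simp [localWeight]

/-- The norm of the frame of the preferred chart, seen from the chart `e`, cancels the
correction term of the local weight. -/
lemma norm_jacobian_pow_mul_exp {k : ℕ} (φ : X → ℝ) {e : atlas (Model n) X} {x : X}
    (hx : x ∈ e.1.source) :
    (‖jacobian n X (achart (Model n) x) e x‖ ^ 2) ^ k * Real.exp (-(k * localWeight φ e x))
      = Real.exp (-(k * φ x)) := by
  have h0 : 0 < ‖jacobian n X (achart (Model n) x) e x‖ ^ 2 := by
    have := norm_jacobian_pos hx
    positivity
  unfold localWeight
  nth_rewrite 1 [← Real.exp_log h0]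
  rw [← Real.exp_nat_mul, ← Real.exp_add]
  congr 1
  ring

lemma pairing_eq_local {k : ℕ} (φ : X → ℝ) (s t : Sections n X k) {e : atlas (Model n) X} {x : X}
    (hx : x ∈ e.1.source) :
    (starRingEnd ℂ (value s x) * value t x) * (Real.exp (-(k * φ x)) : ℂ)
      = (starRingEnd ℂ (localSection s e x) * localSection t e x)
        * (Real.exp (-(k * localWeight φ e x)) : ℂ) := by
  rw [← norm_jacobian_pow_mul_exp φ hx]
  unfold localSection
  push_cast
  rw [← Complex.conj_mul']
  simp only [map_mul, map_pow, mul_pow]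
  ring

/-- The pointwise pairing of two sections with respect to a smooth metric is continuous, although
neither factor need be: the preferred charts jump. -/
lemma continuous_pairing {k : ℕ} {φ : X → ℝ} (hφ : IsSmoothMetric n φ) (s t : Sections n X k) :
    Continuous fun x =>
      (starRingEnd ℂ (value s x) * value t x) * (Real.exp (-(k * φ x)) : ℂ) := by
  refine continuous_of_forall_chart (n := n) fun e => ?_
  refine ContinuousOn.congr ?_ fun x hx => pairing_eq_local φ s t hx
  have h1 := continuousOn_localSection s e
  have h2 := continuousOn_localSection t e
  have h3 := continuousOn_localWeight hφ e
  refine (((Complex.continuous_conj.comp_continuousOn h1).mul h2)).mul ?_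
  exact Complex.continuous_ofReal.comp_continuousOn
    (Real.continuous_exp.comp_continuousOn (continuousOn_const.mul h3).neg)

end Cocycle

/-! ### Metrics attached to sections -/

section FubiniStudy

variable {n : ℕ} {X : Type*} [TopologicalSpace X] [ChartedSpace (Model n) X]
  [IsManifold 𝓘(ℂ, Model n) ω X]
  {k : ℕ} {ι : Type*} [Fintype ι]

/-- The metric `k⁻¹ log (c ∑ |s_i|²)` on `-K_X` attached to finitely many sections of `-k K_X`
without common zeros. -/
noncomputable def logSum (k : ℕ) (c : ℝ) (s : ι → Sections n X k) (x : X) : ℝ :=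
  (k : ℝ)⁻¹ * Real.log (c * ∑ i, ‖value (s i) x‖ ^ 2)

lemma sum_sq_pos {s : ι → Sections n X k} {x : X} (hs : ∃ i, value (s i) x ≠ 0) :
    0 < ∑ i, ‖value (s i) x‖ ^ 2 := by
  obtain ⟨i, hi⟩ := hs
  exact Finset.sum_pos' (fun _ _ => by positivity) ⟨i, Finset.mem_univ _, by positivity⟩

lemma sum_sq_local_eq (s : ι → Sections n X k) (e : atlas (Model n) X) (x : X) :
    ∑ i, ‖localSection (s i) e x‖ ^ 2
      = (‖jacobian n X (achart (Model n) x) e x‖ ^ 2) ^ k * ∑ i, ‖value (s i) x‖ ^ 2 := by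
  rw [Finset.mul_sum]
  refine Finset.sum_congr rfl fun i _ => ?_
  rw [localSection, norm_mul, norm_pow]
  ring

lemma sum_sq_local_pos {s : ι → Sections n X k} {e : atlas (Model n) X} {x : X}
    (hx : x ∈ e.1.source) (hs : ∃ i, value (s i) x ≠ 0) :
    0 < ∑ i, ‖localSection (s i) e x‖ ^ 2 := by
  rw [sum_sq_local_eq]
  have := norm_jacobian_pos hx
  have := sum_sq_pos hs
  positivity

lemma localWeight_logSum (hk : 1 ≤ k) {c : ℝ} (hc : 0 < c) {s : ι → Sections n X k}
    {e : atlas (Model n) X} {x : X} (hx : x ∈ e.1.source) (hs : ∃ i, value (s i) x ≠ 0) :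
    localWeight (logSum k c s) e x
      = (k : ℝ)⁻¹ * (Real.log c + Real.log (∑ i, ‖localSection (s i) e x‖ ^ 2)) := by
  have hk' : (k : ℝ) ≠ 0 := by positivity
  have h1 := norm_jacobian_pos hx
  have h2 := sum_sq_pos hs
  rw [sum_sq_local_eq, localWeight, logSum, Real.log_mul hc.ne' h2.ne',
    Real.log_mul (by positivity) h2.ne', Real.log_pow _ k]
  field_simp
  ring

lemma isSmoothMetric_logSum (hk : 1 ≤ k) {c : ℝ} (hc : 0 < c) {s : ι → Sections n X k}
    (hs : ∀ x, ∃ i, value (s i) x ≠ 0) : IsSmoothMetric n (logSum k c s) := by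
  intro e
  have h : ContDiffOn ℝ ∞ (fun z => (k : ℝ)⁻¹ * (Real.log c
      + Real.log (∑ i, ‖(localSection (s i) e ∘ e.1.symm) z‖ ^ 2))) e.1.target := by
    refine contDiffOn_const.mul (contDiffOn_const.add (ContDiffOn.log ?_ ?_))
    · refine ContDiffOn.sum fun i _ => ContDiffOn.norm_sq ℂ ?_
      exact ((contDiffOn_localSection (s i) e).restrict_scalars ℝ).of_le (by simp)
    · intro z hz
      exact (sum_sq_local_pos (e.1.map_target hz) (hs _)).ne'
  exact h.congr fun z hz => localWeight_logSum hk hc (e.1.map_target hz) (hs _)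

end FubiniStudy

/-! ### The volume form of a metric -/

section Measure

open MeasureTheory Set

lemma measurableSet_chart_preimage {n : ℕ} {X : Type*} [TopologicalSpace X]
    [ChartedSpace (Model n) X] [MeasurableSpace X] [BorelSpace X] (e : atlas (Model n) X)
    {A : Set X} (hA : MeasurableSet A) :
    MeasurableSet (e.1.target ∩ e.1.symm ⁻¹' A) := by
  have h : Measurable (e.1.target.domRestrict e.1.symm) :=
    (continuousOn_iff_continuous_domRestrict.1 e.1.continuousOn_symm).measurable
  have := e.1.open_target.measurableSet.subtype_image (h hA)
  convert this using 1
  ext z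
  simp [and_comm]

variable {n : ℕ} {X : Type*} [TopologicalSpace X] [ChartedSpace (Model n) X]
  [IsManifold 𝓘(ℂ, Model n) ω X]

lemma localWeight_change (φ : X → ℝ) {e e' : atlas (Model n) X} {x : X}
    (he : x ∈ e.1.source) (he' : x ∈ e'.1.source) :
    localWeight φ e' x = localWeight φ e x + Real.log (‖jacobian n X e e' x‖ ^ 2) := by
  have h1 := norm_jacobian_pos he
  have h2 := norm_pos_iff.2 (jacobian_ne_zero he he')
  rw [localWeight, localWeight, ← jacobian_mul (mem_chart_source _ x) he he', norm_mul, mul_pow,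
    Real.log_mul (by positivity) (by positivity)]
  change _ + (_ + Real.log (‖jacobian n X (achart (Model n) x) e x‖ ^ 2)) = _
  ring

lemma weightInChart_add (φ h : X → ℝ) (e : atlas (Model n) X) (z : Model n) :
    weightInChart (fun x => φ x + h x) e z = weightInChart φ e z + h (e.1.symm z) := by
  simp only [weightInChart, localWeight]
  ring

/-- The real Jacobian determinant of a change of holomorphic coordinates is the squared modulus
of the complex one. -/
lemma abs_det_transition (i j : atlas (Model n) X) {z : Model n} (hz : z ∈ i.1.target) :
    |((fderiv ℂ (j.1 ∘ i.1.symm) z).restrictScalars ℝ).det|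
      = ‖jacobian n X i j (i.1.symm z)‖ ^ 2 := by
  have h : ((fderiv ℂ (j.1 ∘ i.1.symm) z).restrictScalars ℝ).det
      = Complex.normSq (jacobian n X i j (i.1.symm z)) := by
    rw [jacobian, coordChange_eq_fderiv i j hz, ← Algebra.norm_complex_apply,
      ContinuousLinearMap.det, ContinuousLinearMap.det, ← LinearMap.det_restrictScalars]
    rfl
  rw [h, Complex.normSq_eq_norm_sq, abs_of_nonneg (by positivity)]

lemma aemeasurable_density {φ : X → ℝ} (hφ : IsSmoothMetric n φ) (e : atlas (Model n) X) :
    AEMeasurable (fun z => ENNReal.ofReal (Real.exp (-weightInChart φ e z)))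
      (volume.restrict e.1.target) :=
  ENNReal.measurable_ofReal.comp_aemeasurable
    ((Real.continuous_exp.comp_continuousOn (hφ e).continuousOn.neg).aemeasurable
      e.1.open_target.measurableSet)

variable [MeasurableSpace X]

/-- The measure with density `e^{-φ_e}` in the chart `e`, transported to `X`. -/
noncomputable def chartVol (φ : X → ℝ) (e : atlas (Model n) X) : Measure X :=
  Measure.map e.1.symm ((volume.restrict e.1.target).withDensity
    fun z => ENNReal.ofReal (Real.exp (-weightInChart φ e z)))

variable [BorelSpace X]

lemma aemeasurable_chart_symm (φ : X → ℝ) (e : atlas (Model n) X) :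
    AEMeasurable e.1.symm ((volume.restrict e.1.target).withDensity
      fun z => ENNReal.ofReal (Real.exp (-weightInChart φ e z))) :=
  (e.1.continuousOn_symm.aemeasurable e.1.open_target.measurableSet).mono_ac
    (withDensity_absolutelyContinuous _ _)

lemma chartVol_apply (φ : X → ℝ) (e : atlas (Model n) X) {A : Set X} (hA : MeasurableSet A) :
    chartVol φ e A = ∫⁻ z in e.1.target ∩ e.1.symm ⁻¹' A,
      ENNReal.ofReal (Real.exp (-weightInChart φ e z)) := by
  rw [chartVol, Measure.map_apply_of_aemeasurable (aemeasurable_chart_symm φ e) hA,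
    withDensity_apply', Measure.restrict_restrict' e.1.open_target.measurableSet, inter_comm]

lemma chartVol_inter_source (φ : X → ℝ) (e : atlas (Model n) X) {A : Set X}
    (hA : MeasurableSet A) : chartVol φ e (A ∩ e.1.source) = chartVol φ e A := by
  rw [chartVol_apply φ e hA, chartVol_apply φ e (hA.inter e.1.open_source.measurableSet)]
  congr 2
  ext z
  simp only [mem_inter_iff, mem_preimage]
  exact ⟨fun h => ⟨h.1, h.2.1⟩, fun h => ⟨h.1, h.2, e.1.map_target h.1⟩⟩

/-- The local measures of two charts agree on the overlap. -/
lemma chartVol_congr (φ : X → ℝ) {e e' : atlas (Model n) X} {A : Set X} (hA : MeasurableSet A)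
    (he : A ⊆ e.1.source) (he' : A ⊆ e'.1.source) : chartVol φ e A = chartVol φ e' A := by
  have himage : e'.1.target ∩ e'.1.symm ⁻¹' A
      = (e'.1 ∘ e.1.symm) '' (e.1.target ∩ e.1.symm ⁻¹' A) := by
    ext w
    constructor
    · rintro ⟨hw, hwA⟩
      refine ⟨e.1 (e'.1.symm w), ⟨e.1.map_source (he hwA), ?_⟩, ?_⟩
      · simpa [e.1.left_inv (he hwA)] using hwA
      · simp [e.1.left_inv (he hwA), e'.1.right_inv hw]
    · rintro ⟨z, ⟨hz, hzA⟩, rfl⟩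
      refine ⟨e'.1.map_source (he' hzA), ?_⟩
      simpa [e'.1.left_inv (he' hzA)] using hzA
  have hmeas := measurableSet_chart_preimage e hA
  have hinj : InjOn (e'.1 ∘ e.1.symm) (e.1.target ∩ e.1.symm ⁻¹' A) := by
    intro z hz w hw hzw
    exact e.1.symm.injOn hz.1 hw.1 (e'.1.injOn (he' hz.2) (he' hw.2) hzw)
  have hderiv : ∀ z ∈ e.1.target ∩ e.1.symm ⁻¹' A, HasFDerivWithinAt (e'.1 ∘ e.1.symm)
      ((fderiv ℂ (e'.1 ∘ e.1.symm) z).restrictScalars ℝ) (e.1.target ∩ e.1.symm ⁻¹' A) z := by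
    intro z hz
    have h := ((contDiffOn_transition e e').contDiffAt
      ((isOpen_overlap e e').mem_nhds ⟨hz.1, he' hz.2⟩)).differentiableAt (by simp)
    exact (h.hasFDerivAt.restrictScalars ℝ).hasFDerivWithinAt
  rw [chartVol_apply φ e hA, chartVol_apply φ e' hA, himage,
    lintegral_image_eq_lintegral_abs_det_fderiv_mul volume hmeas hderiv hinj]
  refine setLIntegral_congr_fun hmeas fun z hz => ?_
  have hx : e.1.symm z ∈ e.1.source := e.1.map_target hz.1
  have hx' : e.1.symm z ∈ e'.1.source := he' hz.2
  have hpos := norm_pos_iff.2 (jacobian_ne_zero hx hx')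
  simp only [abs_det_transition e e' hz.1]
  rw [← ENNReal.ofReal_mul (by positivity)]
  congr 1
  simp only [weightInChart, Function.comp_apply, e'.1.left_inv hx']
  rw [localWeight_change φ hx hx', neg_add, Real.exp_add, Real.exp_neg (Real.log _),
    Real.exp_log (by positivity)]
  field_simp

/-- A compact manifold is covered by a sequence of charts. -/
lemma exists_chart_cover (n : ℕ) (X : Type*) [TopologicalSpace X] [CompactSpace X] [Nonempty X]
    [ChartedSpace (Model n) X] : ∃ c : ℕ → atlas (Model n) X, ⋃ i, (c i).1.source = univ := by
  obtain ⟨t, ht⟩ := isCompact_univ.elim_finite_subcover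
    (fun e : atlas (Model n) X => e.1.source) (fun e => e.1.open_source)
    (fun x _ => mem_iUnion.2 ⟨achart (Model n) x, mem_chart_source _ x⟩)
  have hne : (t : Set (atlas (Model n) X)).Nonempty := by
    obtain ⟨x⟩ := ‹Nonempty X›
    obtain ⟨e, he⟩ := mem_iUnion.1 (ht (mem_univ x))
    obtain ⟨he, -⟩ := mem_iUnion.1 he
    exact ⟨e, he⟩
  obtain ⟨c, hc⟩ := t.countable_toSet.exists_eq_range hne
  refine ⟨c, eq_univ_of_univ_subset fun x hx => ?_⟩
  obtain ⟨e, he⟩ := mem_iUnion.1 (ht hx)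
  obtain ⟨he, hxe⟩ := mem_iUnion.1 he
  obtain ⟨i, rfl⟩ : e ∈ range c := hc ▸ he
  exact mem_iUnion.2 ⟨i, hxe⟩

variable [CompactSpace X] [Nonempty X]

/-- The supremum defining the volume form restricts to the local measure of each chart: it is
bounded above by the measure glued from the local ones along a countable partition subordinate
to charts. -/
lemma volForm_apply_of_subset (φ : X → ℝ) (e : atlas (Model n) X) {A : Set X}
    (hA : MeasurableSet A) (he : A ⊆ e.1.source) : volForm n φ A = chartVol φ e A := by
  obtain ⟨c, hc⟩ := exists_chart_cover n X
  set P : ℕ → Set X := disjointed fun i => (c i).1.source with hP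
  have hPm : ∀ i, MeasurableSet (P i) := fun i =>
    MeasurableSet.disjointed (fun j => (c j).1.open_source.measurableSet) i
  have hPsub : ∀ i, P i ⊆ (c i).1.source := fun i => disjointed_subset _ i
  have hPU : ⋃ i, P i = univ := by rw [hP, iUnion_disjointed, hc]
  have hPd : Pairwise (Function.onFun Disjoint P) := disjoint_disjointed _
  set ν : Measure X := Measure.sum fun i => (chartVol φ (c i)).restrict (P i) with hν
  have hνA : ∀ (e : atlas (Model n) X) {B : Set X}, MeasurableSet B → B ⊆ e.1.source →
      ν B = chartVol φ e B := by
    intro e B hB hBe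
    have hB' : B = ⋃ i, B ∩ P i := by rw [← inter_iUnion, hPU, inter_univ]
    rw [hν, Measure.sum_apply _ hB]
    conv_rhs => rw [hB']
    rw [measure_iUnion (fun i j hij => (hPd hij).mono inter_subset_right inter_subset_right)
      fun i => hB.inter (hPm i)]
    refine tsum_congr fun i => ?_
    rw [Measure.restrict_apply hB]
    exact chartVol_congr φ (hB.inter (hPm i)) (inter_subset_right.trans (hPsub i))
      (inter_subset_left.trans hBe)
  have hle : volForm n φ ≤ ν := by
    refine iSup_le fun e => Measure.le_iff.2 fun B hB => ?_
    change chartVol φ e B ≤ ν B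
    rw [← chartVol_inter_source φ e hB,
      ← hνA e (hB.inter e.1.open_source.measurableSet) inter_subset_right]
    exact measure_mono inter_subset_left
  refine le_antisymm ((hle A).trans (hνA e hA he).le) ?_
  exact le_iSup (fun e : atlas (Model n) X => chartVol φ e) e A

lemma volForm_restrict_source (φ : X → ℝ) (e : atlas (Model n) X) :
    (volForm n φ).restrict e.1.source = chartVol φ e := by
  ext A hA
  rw [Measure.restrict_apply hA, volForm_apply_of_subset φ e
    (hA.inter e.1.open_source.measurableSet) inter_subset_right, chartVol_inter_source φ e hA]

lemma isFiniteMeasure_volForm {φ : X → ℝ} (hφ : IsSmoothMetric n φ) :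
    IsFiniteMeasure (volForm n φ) := by
  have : IsLocallyFiniteMeasure (volForm n φ) := by
    refine ⟨fun x => ?_⟩
    set e := achart (Model n) x
    have hx : x ∈ e.1.source := mem_chart_source _ x
    obtain ⟨r, hr, hball⟩ := Metric.nhds_basis_closedBall.mem_iff.1
      (e.1.open_target.mem_nhds (e.1.map_source hx))
    refine ⟨e.1.source ∩ e.1 ⁻¹' Metric.ball (e.1 x) r,
      (e.1.isOpen_inter_preimage Metric.isOpen_ball).mem_nhds ⟨hx, Metric.mem_ball_self hr⟩, ?_⟩
    have hm := (e.1.isOpen_inter_preimage (Metric.isOpen_ball (x := e.1 x) (ε := r))).measurableSet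
    rw [volForm_apply_of_subset φ e hm inter_subset_left, chartVol_apply φ e hm]
    refine lt_of_le_of_lt (lintegral_mono_set (t := Metric.closedBall (e.1 x) r) ?_) ?_
    · rintro z ⟨hz, hz'⟩
      have := hz'.2
      simp only [mem_preimage, e.1.right_inv hz] at this
      exact Metric.ball_subset_closedBall this
    · have hc : ContinuousOn (fun z => Real.exp (-weightInChart φ e z))
          (Metric.closedBall (e.1 x) r) :=
        Real.continuous_exp.comp_continuousOn ((hφ e).continuousOn.mono hball).neg
      have := (hc.integrableOn_compact (μ := volume) (isCompact_closedBall _ _)).lintegral_lt_top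
      exact this
  exact CompactSpace.isFiniteMeasure

lemma isOpenPosMeasure_volForm {φ : X → ℝ} (hφ : IsSmoothMetric n φ) :
    (volForm n φ).IsOpenPosMeasure := by
  refine ⟨fun U hU hne h0 => ?_⟩
  obtain ⟨x, hxU⟩ := hne
  set e := achart (Model n) x
  have hx : x ∈ e.1.source := mem_chart_source _ x
  have hUo : IsOpen (U ∩ e.1.source) := hU.inter e.1.open_source
  have h1 : volForm n φ (U ∩ e.1.source) = 0 := measure_mono_null inter_subset_left h0
  rw [volForm_apply_of_subset φ e hUo.measurableSet inter_subset_right,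
    chartVol_apply φ e hUo.measurableSet,
    lintegral_eq_zero_iff' ((aemeasurable_density hφ e).mono_measure
      (Measure.restrict_mono inter_subset_left le_rfl))] at h1
  have hSo : IsOpen (e.1.target ∩ e.1.symm ⁻¹' (U ∩ e.1.source)) :=
    e.1.isOpen_inter_preimage_symm hUo
  have h2 : volume.restrict (e.1.target ∩ e.1.symm ⁻¹' (U ∩ e.1.source)) univ = 0 := by
    refine measure_mono_null (fun z _ => ?_) h1
    simpa using Real.exp_pos _
  rw [Measure.restrict_apply_univ] at h2
  refine hSo.measure_ne_zero volume ⟨e.1 x, e.1.map_source hx, ?_⟩ h2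
  simp only [mem_preimage, e.1.left_inv hx]
  exact ⟨hxU, hx⟩

/-- Changing the metric by a continuous function changes the volume form by a density. -/
lemma volForm_add {φ h : X → ℝ} (hφ : IsSmoothMetric n φ) (hh : Continuous h) :
    volForm n (fun x => φ x + h x)
      = (volForm n φ).withDensity fun x => ENNReal.ofReal (Real.exp (-h x)) := by
  obtain ⟨c, hc⟩ := exists_chart_cover n X
  rw [Measure.ext_iff_of_iUnion_eq_univ hc]
  intro i
  set e := c i
  have hg : Measurable fun x => ENNReal.ofReal (Real.exp (-h x)) := by fun_prop
  rw [restrict_withDensity e.1.open_source.measurableSet, volForm_restrict_source,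
    volForm_restrict_source]
  ext A hA
  rw [chartVol_apply _ e hA, withDensity_apply _ hA, chartVol,
    Measure.restrict_map_of_aemeasurable (aemeasurable_chart_symm φ e) hA,
    lintegral_map' hg.aemeasurable
      ((aemeasurable_chart_symm φ e).mono_measure Measure.restrict_le_self),
    restrict_withDensity', Measure.restrict_restrict' e.1.open_target.measurableSet]
  rw [inter_comm]
  have hd : AEMeasurable (fun z => ENNReal.ofReal (Real.exp (-weightInChart φ e z)))
      (volume.restrict (e.1.symm ⁻¹' A ∩ e.1.target)) :=
    (aemeasurable_density hφ e).mono_measure (Measure.restrict_mono inter_subset_right le_rfl)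
  rw [lintegral_withDensity_eq_lintegral_mul₀' hd]
  · refine lintegral_congr fun z => ?_
    simp only [Pi.mul_apply]
    rw [weightInChart_add, ← ENNReal.ofReal_mul (by positivity), ← Real.exp_add]
    congr 2
    ring
  · refine hg.comp_aemeasurable (AEMeasurable.mono_ac ?_ (withDensity_absolutelyContinuous _ _))
    exact (e.1.continuousOn_symm.aemeasurable e.1.open_target.measurableSet).mono_measure
      (Measure.restrict_mono inter_subset_right le_rfl)

lemma integral_volForm_add {φ h : X → ℝ} (hφ : IsSmoothMetric n φ) (hh : Continuous h)
    {E : Type*} [NormedAddCommGroup E] [NormedSpace ℝ E] (F : X → E) :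
    ∫ x, F x ∂volForm n (fun x => φ x + h x) = ∫ x, Real.exp (-h x) • F x ∂volForm n φ := by
  rw [volForm_add hφ hh, integral_withDensity_eq_integral_toReal_smul (by fun_prop) (by simp)]
  simp [ENNReal.toReal_ofReal (Real.exp_pos _).le]

end Measure

/-! ### Gram matrices -/

section LinearAlgebra

open Matrix
open scoped ComplexOrder

variable {V : Type*} [AddCommGroup V] [Module ℂ V]

lemma exists_orthonormal [FiniteDimensional ℂ V] (c : InnerProductSpace.Core ℂ V) :
    ∃ s : Fin (Module.finrank ℂ V) → V, ∀ i j, c.inner (s i) (s j) = if i = j then 1 else 0 := by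
  let _ : NormedAddCommGroup V := c.toNormedAddCommGroup
  let _ : InnerProductSpace ℂ V := InnerProductSpace.ofCore c.toCore
  exact ⟨stdOrthonormalBasis ℂ V,
    orthonormal_iff_ite.1 (stdOrthonormalBasis ℂ V).orthonormal⟩

lemma posDef_gram {ι : Type*} [Fintype ι] (c : InnerProductSpace.Core ℂ V)
    {v : ι → V} (hv : LinearIndependent ℂ v) :
    (Matrix.of fun i j => c.inner (v i) (v j)).PosDef := by
  let _ : NormedAddCommGroup V := c.toNormedAddCommGroup
  let _ : InnerProductSpace ℂ V := InnerProductSpace.ofCore c.toCore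
  exact Matrix.posDef_gram_of_linearIndependent hv

lemma linearIndependent_of_orthonormal {ι : Type*} [DecidableEq ι]
    (c : InnerProductSpace.Core ℂ V) {s : ι → V}
    (hs : ∀ i j, c.inner (s i) (s j) = if i = j then 1 else 0) : LinearIndependent ℂ s := by
  let _ : NormedAddCommGroup V := c.toNormedAddCommGroup
  let _ : InnerProductSpace ℂ V := InnerProductSpace.ofCore c.toCore
  exact (orthonormal_iff_ite.2 hs).linearIndependent

/-- The Gram matrix of a Hermitian form transforms by congruence under a change of vectors. -/
lemma gram_eq_conjTranspose_mul {ι : Type*} [Fintype ι] (c : InnerProductSpace.Core ℂ V)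
    {b s : ι → V} {P : Matrix ι ι ℂ} (hP : ∀ j, b j = ∑ i, P i j • s i) :
    (Matrix.of fun i j => c.inner (b i) (b j))
      = Pᴴ * (Matrix.of fun i j => c.inner (s i) (s j)) * P := by
  let _ : NormedAddCommGroup V := c.toNormedAddCommGroup
  let _ : InnerProductSpace ℂ V := InnerProductSpace.ofCore c.toCore
  ext i j
  change inner ℂ (b i) (b j) = _
  rw [hP i, hP j]
  simp only [Matrix.mul_apply, Finset.sum_mul, Finset.mul_sum, sum_inner, inner_sum, inner_smul_left,
    inner_smul_right, Matrix.conjTranspose_apply, Matrix.of_apply]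
  refine Finset.sum_congr rfl fun x _ => Finset.sum_congr rfl fun y _ => ?_
  change _ = star (P y i) * inner ℂ (s y) (s x) * P x j
  rw [Complex.star_def]
  ring

/-- The determinants of two Hermitian inner products in a given basis differ by the factor which is
the determinant of the second one in an orthonormal basis of the first one. -/
lemma det_gram_eq_mul {ι : Type*} [Fintype ι] [DecidableEq ι] (c c' : InnerProductSpace.Core ℂ V)
    (b : Module.Basis ι ℂ V) {s : ι → V}
    (hs : ∀ i j, c.inner (s i) (s j) = if i = j then 1 else 0) :
    (Matrix.of fun i j => c'.inner (b i) (b j)).det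
      = (Matrix.of fun i j => c.inner (b i) (b j)).det
        * (Matrix.of fun i j => c'.inner (s i) (s j)).det := by
  have : FiniteDimensional ℂ V := b.finiteDimensional_of_finite
  let e : Module.Basis ι ℂ V := basisOfLinearIndependentOfCardEqFinrank'
    s (linearIndependent_of_orthonormal c hs) (Module.finrank_eq_card_basis b).symm
  have he : ∀ i, e i = s i := fun i => by simp [e]
  have hP : ∀ j, b j = ∑ i, e.toMatrix b i j • s i := fun j => by
    rw [← e.sum_toMatrix_smul_self b j]
    simp [he]
  have h1 : (Matrix.of fun i j => c.inner (s i) (s j)) = (1 : Matrix ι ι ℂ) := by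
    ext i j
    simp [hs, Matrix.one_apply]
  rw [gram_eq_conjTranspose_mul c hP, gram_eq_conjTranspose_mul c' hP, h1]
  simp only [Matrix.det_mul, Matrix.det_one]
  ring

/-- The arithmetic-geometric mean inequality for the eigenvalues of a positive matrix. -/
lemma log_det_le {ι : Type*} [Fintype ι] [DecidableEq ι] [Nonempty ι] {A : Matrix ι ι ℂ}
    (hA : A.PosDef) {m : ℝ} (hm : 0 < m) (htr : A.trace = (Fintype.card ι * m : ℝ)) :
    Real.log A.det.re ≤ Fintype.card ι * Real.log m := by
  have hdet : A.det.re = ∏ i, hA.isHermitian.eigenvalues i := by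
    rw [hA.isHermitian.det_eq_prod_eigenvalues]
    exact_mod_cast Complex.ofReal_re _
  have hsum : ∑ i, hA.isHermitian.eigenvalues i = Fintype.card ι * m := by
    rw [hA.isHermitian.trace_eq_sum_eigenvalues] at htr
    apply Complex.ofReal_injective
    rw [← htr]
    push_cast
    rfl
  have hpos := hA.eigenvalues_pos
  rw [hdet, Real.log_prod fun i _ => (hpos i).ne']
  -- the tangent line to the logarithm at the mean `m` of the eigenvalues
  have h : ∀ i, Real.log (hA.isHermitian.eigenvalues i)
      ≤ hA.isHermitian.eigenvalues i / m - 1 + Real.log m := fun i => by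
    have := Real.log_le_sub_one_of_pos (div_pos (hpos i) hm)
    rw [Real.log_div (hpos i).ne' hm.ne'] at this
    linarith
  refine (Finset.sum_le_sum fun i _ => h i).trans (le_of_eq ?_)
  rw [Finset.sum_add_distrib, Finset.sum_sub_distrib, ← Finset.sum_div, hsum]
  simp
  field_simp
  ring

lemma det_re_pos {ι : Type*} [Fintype ι] [DecidableEq ι] {A : Matrix ι ι ℂ} (hA : A.PosDef) :
    0 < A.det.re :=
  (Complex.pos_iff.1 hA.det_pos).1

end LinearAlgebra

/-! ### The two comparisons -/

section Ding

open MeasureTheory Set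

lemma neZero_of_isOpenPosMeasure {X : Type*} [TopologicalSpace X] [Nonempty X]
    [MeasurableSpace X] (μ : Measure X) [μ.IsOpenPosMeasure] : NeZero μ :=
  ⟨fun h => isOpen_univ.measure_ne_zero μ univ_nonempty (by rw [h]; rfl)⟩

lemma integrable_of_continuous {E : Type*} [NormedAddCommGroup E] {X : Type*} [TopologicalSpace X]
    [MeasurableSpace X] [BorelSpace X] [CompactSpace X] [SecondCountableTopologyEither X E]
    {μ : Measure X} [IsFiniteMeasure μ] {f : X → E} (hf : Continuous f) : Integrable f μ :=
  hf.integrable_of_hasCompactSupport (HasCompactSupport.of_compactSpace f)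

/-- The reverse Hölder inequality behind the first comparison: if `∫ e^{k h} = 1` then
`(∫ 1)^{1 + γ/k} ≤ ∫ e^{-γ h}`. -/
lemma log_measure_le_log_integral_exp {X : Type*} [TopologicalSpace X] [MeasurableSpace X]
    [BorelSpace X] [CompactSpace X] {μ : Measure X} [IsFiniteMeasure μ] [NeZero μ] {h : X → ℝ}
    (hh : Continuous h) {κ γ : ℝ} (hκ : 0 < κ) (hγ : 0 < γ)
    (h1 : ∫ x, Real.exp (κ * h x) ∂μ = 1) :
    (1 + γ / κ) * Real.log (μ.real univ) ≤ Real.log (∫ x, Real.exp (-(γ * h x)) ∂μ) := by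
  set V := μ.real univ with hV
  have hVpos : 0 < V := measureReal_univ_pos
  have hi1 : Integrable (fun x => Real.exp (κ * h x)) μ :=
    integrable_of_continuous (by fun_prop)
  have hi2 : Integrable (fun x => Real.exp (-(γ * h x))) μ :=
    integrable_of_continuous (by fun_prop)
  -- `y ^ (-γ/κ) ≥ 1 - (γ/κ) (y - 1)` at `y = V e^{κ h}`, a function of mean value `1`
  have hpt : ∀ x, 1 - γ / κ * (V * Real.exp (κ * h x) - 1)
      ≤ Real.exp (-(γ / κ * Real.log V)) * Real.exp (-(γ * h x)) := by
    intro x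
    rw [← Real.exp_add]
    have h2 : Real.log (V * Real.exp (κ * h x)) = Real.log V + κ * h x := by
      rw [Real.log_mul hVpos.ne' (Real.exp_pos _).ne', Real.log_exp]
    have h3 := Real.log_le_sub_one_of_pos (mul_pos hVpos (Real.exp_pos (κ * h x)))
    rw [h2] at h3
    have h4 := mul_le_mul_of_nonneg_left h3 (div_pos hγ hκ).le
    have h5 := Real.add_one_le_exp (-(γ / κ * Real.log V) + -(γ * h x))
    have h6 : γ / κ * (Real.log V + κ * h x) = γ / κ * Real.log V + γ * h x := by
      field_simp
    linarith
  have hint := integral_mono (μ := μ) (f := fun x => 1 - γ / κ * (V * Real.exp (κ * h x) - 1))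
    (integrable_of_continuous (by fun_prop)) (hi2.const_mul _) hpt
  have hI1 : ∫ x, (1 - γ / κ * (V * Real.exp (κ * h x) - 1)) ∂μ = V := by
    have : ∀ x, 1 - γ / κ * (V * Real.exp (κ * h x) - 1)
        = (1 + γ / κ) - γ / κ * V * Real.exp (κ * h x) := fun x => by ring
    simp only [this]
    rw [integral_sub (integrable_const _) (hi1.const_mul _), integral_const_mul, h1,
      integral_const, ← hV, smul_eq_mul]
    ring
  have hle : V ≤ Real.exp (-(γ / κ * Real.log V)) * ∫ x, Real.exp (-(γ * h x)) ∂μ := by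
    rw [← integral_const_mul]
    exact hI1.symm.le.trans hint
  have hIpos : 0 < ∫ x, Real.exp (-(γ * h x)) ∂μ :=
    pos_of_mul_pos_right (hVpos.trans_le hle) (Real.exp_pos _).le
  have := Real.log_le_log hVpos hle
  rw [Real.log_mul (Real.exp_pos _).ne' hIpos.ne', Real.log_exp] at this
  linarith

variable {n : ℕ} {X : Type*} [TopologicalSpace X] [ChartedSpace (Model n) X]
  [IsManifold 𝓘(ℂ, Model n) ω X]

lemma weightInChart_combo (a : ℝ) (φ ψ : X → ℝ) (e : atlas (Model n) X) (z : Model n) :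
    weightInChart (fun x => a * φ x + (1 - a) * ψ x) e z
      = a * weightInChart φ e z + (1 - a) * weightInChart ψ e z := by
  simp only [weightInChart, localWeight]
  ring

lemma IsSmoothMetric.combo {φ ψ : X → ℝ} (hφ : IsSmoothMetric n φ) (hψ : IsSmoothMetric n ψ)
    (a : ℝ) : IsSmoothMetric n fun x => a * φ x + (1 - a) * ψ x := fun e =>
  ((contDiffOn_const.mul (hφ e)).add (contDiffOn_const.mul (hψ e))).congr fun z _ =>
    weightInChart_combo a φ ψ e z

variable {k : ℕ}

lemma conj_mul_self_mul_exp (φ : X → ℝ) (s : Sections n X k) (x : X) :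
    (starRingEnd ℂ (value s x) * value s x) * (Real.exp (-(k * φ x)) : ℂ)
      = ((‖value s x‖ ^ 2 * Real.exp (-(k * φ x)) : ℝ) : ℂ) := by
  rw [Complex.conj_mul']
  push_cast
  rfl

lemma continuous_sqNorm {φ : X → ℝ} (hφ : IsSmoothMetric n φ) (s : Sections n X k) :
    Continuous fun x => ‖value s x‖ ^ 2 * Real.exp (-(k * φ x)) := by
  have h := Complex.continuous_re.comp (continuous_pairing hφ s s)
  refine h.congr fun x => ?_
  simp only [Function.comp_apply]
  rw [conj_mul_self_mul_exp, Complex.ofReal_re]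

/-- In finite dimension orthonormal bases exist, so the choice defining `orthonormalBasis` is one. -/
lemma orthonormalBasis_spec [FiniteDimensional ℂ (Sections n X k)]
    (H : HermMetric n X k) (i j : Fin (dimSections n X k)) :
    H.inner (orthonormalBasis H i) (orthonormalBasis H j) = if i = j then 1 else 0 :=
  Classical.epsilon_spec (exists_orthonormal H) i j

/-- A basis of a globally generated space of sections has no common zeros. -/
lemma exists_value_ne_zero [FiniteDimensional ℂ (Sections n X k)]
    (hgg : GloballyGenerated n X k) (H : HermMetric n X k) (x : X) :
    ∃ i, value (orthonormalBasis H i) x ≠ 0 := by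
  by_contra! h
  obtain ⟨s, hs⟩ := hgg x
  have hli := linearIndependent_of_orthonormal H (orthonormalBasis_spec H)
  have hspan := hli.span_eq_top_of_card_eq_finrank' (Fintype.card_fin _)
  have hmem : s ∈ Submodule.span ℂ (range (orthonormalBasis H)) := hspan ▸ Submodule.mem_top
  refine hs ?_
  clear hs
  induction hmem using Submodule.span_induction with
  | mem t ht => obtain ⟨i, rfl⟩ := ht; exact h i
  | zero => rfl
  | add t u _ _ ht hu =>
    change value t x + value u x = 0
    rw [ht, hu, add_zero]
  | smul r t _ ht =>
    change r * value t x = 0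
    rw [ht, mul_zero]

lemma dimSections_pos [Nonempty X] [FiniteDimensional ℂ (Sections n X k)]
    (hgg : GloballyGenerated n X k) : 0 < dimSections n X k := by
  obtain ⟨s, hs⟩ := hgg (Classical.arbitrary X)
  have : Nontrivial (Sections n X k) := ⟨s, 0, fun h => hs (by rw [h]; rfl)⟩
  exact Module.finrank_pos

lemma isSmoothMetric_fubiniStudy [Nonempty X] [FiniteDimensional ℂ (Sections n X k)]
    (hk : 1 ≤ k) (hgg : GloballyGenerated n X k) (H : HermMetric n X k) :
    IsSmoothMetric n (fubiniStudy H) := by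
  have := dimSections_pos hgg
  exact isSmoothMetric_logSum hk (by positivity) (exists_value_ne_zero hgg H)

lemma exp_mul_fubiniStudy [Nonempty X] [FiniteDimensional ℂ (Sections n X k)]
    (hk : 1 ≤ k) (hgg : GloballyGenerated n X k) (H : HermMetric n X k) (x : X) :
    Real.exp (k * fubiniStudy H x)
      = (dimSections n X k : ℝ)⁻¹ * ∑ i, ‖value (orthonormalBasis H i) x‖ ^ 2 := by
  have h1 := dimSections_pos hgg
  have h2 := sum_sq_pos (exists_value_ne_zero hgg H x)
  have hk' : (k : ℝ) ≠ 0 := by positivity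
  rw [fubiniStudy, mul_inv_cancel_left₀ hk', Real.exp_log (by positivity)]

/-- `∑ |s_i|²_{kφ} = N e^{k (FS(H) - φ)}`. -/
lemma sum_sqNorm_eq [Nonempty X] [FiniteDimensional ℂ (Sections n X k)]
    (hk : 1 ≤ k) (hgg : GloballyGenerated n X k) (H : HermMetric n X k) (φ : X → ℝ) (x : X) :
    ∑ i, ‖value (orthonormalBasis H i) x‖ ^ 2 * Real.exp (-(k * φ x))
      = dimSections n X k * Real.exp (k * (fubiniStudy H x - φ x)) := by
  have hN : (dimSections n X k : ℝ) ≠ 0 := (Nat.cast_pos.2 (dimSections_pos hgg)).ne'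
  rw [← Finset.sum_mul, mul_sub, sub_eq_add_neg, Real.exp_add, exp_mul_fubiniStudy hk hgg,
    ← mul_assoc, mul_inv_cancel_left₀ hN]

variable [MeasurableSpace X]

lemma hilbForm_self (φ : X → ℝ) (μ : Measure X) (s : Sections n X k) :
    hilbForm k φ μ s s = ((∫ x, ‖value s x‖ ^ 2 * Real.exp (-(k * φ x)) ∂μ : ℝ) : ℂ) := by
  refine Eq.trans ?_ integral_ofReal
  exact integral_congr_ae (.of_forall fun x => conj_mul_self_mul_exp φ s x)

/-- The rescaled Ding functional on metrics in the normalization of the quantized one. -/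
lemma mul_dingMetric (b : Module.Basis (Fin (dimSections n X k)) ℂ (Sections n X k)) {γ : ℝ}
    (hk : 1 ≤ k) (hγ : 0 < γ) (φ₀ φ : X → ℝ) :
    (1 + γ / k) * dingMetric b γ φ₀ φ
      = 1 / (k * dimSections n X k) * logDet b (hilbForm k φ (twistedVol n γ φ₀ φ))
        - (1 + γ / k) / γ * Real.log ((twistedVol n γ φ₀ φ).real univ) := by
  have hk' : (0 : ℝ) < k := by positivity
  have h1 : (1 + γ / k) * (1 / (dimSections n X k * (k + γ)))
      = 1 / (k * dimSections n X k : ℝ) := by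
    rcases eq_or_ne (dimSections n X k : ℝ) 0 with hN | hN
    · simp [hN]
    · have : (k + γ : ℝ) ≠ 0 := by positivity
      field_simp
  rw [← h1, dingMetric, calL]
  ring

variable [BorelSpace X] [CompactSpace X]

/-- The `L²` form is a Hermitian inner product as soon as the metric is smooth and the measure
is finite and charges all non-empty open sets. -/
@[reducible] noncomputable def hilbCore {φ : X → ℝ} (hφ : IsSmoothMetric n φ) (μ : Measure X)
    [IsFiniteMeasure μ] [μ.IsOpenPosMeasure] : HermMetric n X k where
  inner := hilbForm k φ μ
  conj_inner_symm s t := by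
    rw [hilbForm, ← integral_conj]
    refine integral_congr_ae (.of_forall fun x => ?_)
    simp only [map_mul, Complex.conj_conj, Complex.conj_ofReal]
    ring
  re_inner_nonneg s := by
    rw [hilbForm_self]
    exact integral_nonneg fun x => by positivity
  add_left s t u := by
    simp only [hilbForm]
    rw [← integral_add (integrable_of_continuous (continuous_pairing hφ s u))
      (integrable_of_continuous (continuous_pairing hφ t u))]
    refine integral_congr_ae (.of_forall fun x => ?_)
    have : value (s + t) x = value s x + value t x := rfl
    simp only [this, map_add]
    ring
  smul_left s t r := by
    simp only [hilbForm]
    rw [← integral_const_mul]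
    refine integral_congr_ae (.of_forall fun x => ?_)
    have : value (r • s) x = r * value s x := rfl
    simp only [this, map_mul]
    ring
  definite s hs := by
    rw [hilbForm_self, Complex.ofReal_eq_zero,
      integral_eq_zero_iff_of_nonneg (fun x => by positivity)
        (integrable_of_continuous (continuous_sqNorm hφ s)),
      Continuous.ae_eq_iff_eq μ (continuous_sqNorm hφ s) continuous_zero] at hs
    ext x
    have := congrFun hs x
    simp only [Pi.zero_apply, mul_eq_zero, (Real.exp_pos _).ne', or_false, ne_eq,
      OfNat.ofNat_ne_zero, not_false_eq_true, pow_eq_zero_iff, norm_eq_zero] at this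
    exact this

variable [Nonempty X]

lemma isFiniteMeasure_twistedVol {φ φ₀ : X → ℝ} (hφ : IsSmoothMetric n φ)
    (hφ₀ : IsSmoothMetric n φ₀) (γ : ℝ) : IsFiniteMeasure (twistedVol n γ φ₀ φ) :=
  isFiniteMeasure_volForm (hφ.combo hφ₀ γ)

lemma isOpenPosMeasure_twistedVol {φ φ₀ : X → ℝ} (hφ : IsSmoothMetric n φ)
    (hφ₀ : IsSmoothMetric n φ₀) (γ : ℝ) : (twistedVol n γ φ₀ φ).IsOpenPosMeasure :=
  isOpenPosMeasure_volForm (hφ.combo hφ₀ γ)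

lemma integral_twistedVol_add {φ φ₀ h : X → ℝ} (hφ : IsSmoothMetric n φ)
    (hφ₀ : IsSmoothMetric n φ₀) (hh : Continuous h) (γ : ℝ)
    {E : Type*} [NormedAddCommGroup E] [NormedSpace ℝ E] (F : X → E) :
    ∫ x, F x ∂twistedVol n γ φ₀ (fun x => φ x + h x)
      = ∫ x, Real.exp (-(γ * h x)) • F x ∂twistedVol n γ φ₀ φ := by
  have h1 : (fun x => γ * (φ x + h x) + (1 - γ) * φ₀ x)
      = fun x => (γ * φ x + (1 - γ) * φ₀ x) + γ * h x := by
    ext x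
    ring
  have h2 : Continuous fun x => γ * h x := continuous_const.mul hh
  rw [twistedVol, h1, integral_volForm_add (hφ.combo hφ₀ γ) h2]
  rfl

lemma twistedVol_real_univ_add {φ φ₀ h : X → ℝ} (hφ : IsSmoothMetric n φ)
    (hφ₀ : IsSmoothMetric n φ₀) (hh : Continuous h) (γ : ℝ) :
    (twistedVol n γ φ₀ (fun x => φ x + h x)).real univ
      = ∫ x, Real.exp (-(γ * h x)) ∂twistedVol n γ φ₀ φ := by
  have := integral_twistedVol_add hφ hφ₀ hh γ (fun _ => (1 : ℝ))
  simpa using this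

lemma sum_hilbForm_eq [FiniteDimensional ℂ (Sections n X k)]
    (hk : 1 ≤ k) (hgg : GloballyGenerated n X k) (H : HermMetric n X k) {φ : X → ℝ}
    (hφ : IsSmoothMetric n φ) (μ : Measure X) [IsFiniteMeasure μ] :
    ∑ i, hilbForm k φ μ (orthonormalBasis H i) (orthonormalBasis H i)
      = ((dimSections n X k * ∫ x, Real.exp (k * (fubiniStudy H x - φ x)) ∂μ : ℝ) : ℂ) := by
  simp only [hilbForm_self]
  rw [← Complex.ofReal_sum, ← integral_finsetSum _ fun i _ =>
    integrable_of_continuous (continuous_sqNorm hφ _), ← integral_const_mul]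
  congr 1
  exact integral_congr_ae (.of_forall fun x => sum_sqNorm_eq hk hgg H φ x)

variable (b : Module.Basis (Fin (dimSections n X k)) ℂ (Sections n X k)) {γ : ℝ}

/-- The first comparison, for the inner product `H` given by the `L²` form of `φ`. -/
lemma dingQuantized_le (hk : 1 ≤ k) (hgg : GloballyGenerated n X k) (hγ : 0 < γ)
    {φ φ₀ : X → ℝ} (hφ : IsSmoothMetric n φ) (hφ₀ : IsSmoothMetric n φ₀) {H : HermMetric n X k}
    (hH : ∀ s t, H.inner s t = hilbForm k φ (twistedVol n γ φ₀ φ) s t) :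
    dingQuantized b γ φ₀ H ≤ (1 + γ / k) * dingMetric b γ φ₀ φ := by
  have : FiniteDimensional ℂ (Sections n X k) := b.finiteDimensional_of_finite
  have := isFiniteMeasure_twistedVol hφ hφ₀ γ
  have := isOpenPosMeasure_twistedVol hφ hφ₀ γ
  have hk' : (0 : ℝ) < k := by positivity
  have hN : (0 : ℝ) < dimSections n X k := Nat.cast_pos.2 (dimSections_pos hgg)
  have hFS := isSmoothMetric_fubiniStudy hk hgg H
  have hcont : Continuous fun x => fubiniStudy H x - φ x := continuous_sub_of_smooth hFS hφ
  have hone : ∫ x, Real.exp (k * (fubiniStudy H x - φ x)) ∂twistedVol n γ φ₀ φ = 1 := by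
    have h := sum_hilbForm_eq hk hgg H hφ (twistedVol n γ φ₀ φ)
    simp only [← hH, orthonormalBasis_spec, if_true, Finset.sum_const, Finset.card_univ,
      Fintype.card_fin, nsmul_eq_mul, mul_one] at h
    have h' : (dimSections n X k : ℝ)
        = dimSections n X k * ∫ x, Real.exp (k * (fubiniStudy H x - φ x)) ∂twistedVol n γ φ₀ φ := by
      exact_mod_cast h
    exact mul_left_cancel₀ hN.ne' (h'.symm.trans (mul_one _).symm)
  have := neZero_of_isOpenPosMeasure (twistedVol n γ φ₀ φ)
  have hkey := log_measure_le_log_integral_exp hcont hk' hγ hone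
  rw [← twistedVol_real_univ_add hφ hφ₀ hcont γ] at hkey
  simp only [add_sub_cancel] at hkey
  have hdet : logDet b H.inner = logDet b (hilbForm k φ (twistedVol n γ φ₀ φ)) := by
    simp only [logDet, hH]
  rw [mul_dingMetric b hk hγ, dingQuantized, hdet]
  have := mul_le_mul_of_nonneg_left hkey (one_div_pos.2 hγ).le
  have h2 : 1 / γ * ((1 + γ / k) * Real.log ((twistedVol n γ φ₀ φ).real univ))
      = (1 + γ / k) / γ * Real.log ((twistedVol n γ φ₀ φ).real univ) := by ring
  linarith

/-- The second comparison: the `L²` form of `FS(H)` has trace `N ∫ e^{-(γ FS(H) + (1 - γ) φ₀)}`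
relatively to `H`. -/
lemma dingMetric_fubiniStudy_le (hk : 1 ≤ k) (hgg : GloballyGenerated n X k) (hγ : 0 < γ)
    {φ₀ : X → ℝ} (hφ₀ : IsSmoothMetric n φ₀) (H : HermMetric n X k) :
    (1 + γ / k) * dingMetric b γ φ₀ (fubiniStudy H) ≤ dingQuantized b γ φ₀ H := by
  have : FiniteDimensional ℂ (Sections n X k) := b.finiteDimensional_of_finite
  have hφ := isSmoothMetric_fubiniStudy hk hgg H
  have := isFiniteMeasure_twistedVol hφ hφ₀ γ
  have := isOpenPosMeasure_twistedVol hφ hφ₀ γ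
  have hk' : (0 : ℝ) < k := by positivity
  have hNpos := dimSections_pos hgg
  have hN : (0 : ℝ) < dimSections n X k := Nat.cast_pos.2 hNpos
  have : Nonempty (Fin (dimSections n X k)) := ⟨⟨0, hNpos⟩⟩
  have := neZero_of_isOpenPosMeasure (twistedVol n γ φ₀ (fubiniStudy H))
  set μ := twistedVol n γ φ₀ (fubiniStudy H) with hμ
  set K : HermMetric n X k := hilbCore hφ μ with hK
  have hV : 0 < μ.real univ := measureReal_univ_pos
  have htr : (Matrix.of fun i j => K.inner (orthonormalBasis H i) (orthonormalBasis H j)).trace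
      = ((Fintype.card (Fin (dimSections n X k)) * μ.real univ : ℝ) : ℂ) := by
    have h := sum_hilbForm_eq hk hgg H hφ μ
    simp only [sub_self, mul_zero, Real.exp_zero, integral_const, smul_eq_mul, mul_one] at h
    rw [Fintype.card_fin]
    exact h
  have hs := orthonormalBasis_spec H
  have hpos := posDef_gram K (linearIndependent_of_orthonormal H hs)
  have hle := log_det_le hpos hV htr
  have hdet : logDet b (hilbForm k (fubiniStudy H) μ) = logDet b H.inner + Real.log
      (Matrix.of fun i j => K.inner (orthonormalBasis H i) (orthonormalBasis H j)).det.re := by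
    have h1 := det_gram_eq_mul H K b hs
    have hA := (Complex.pos_iff.1 hpos.det_pos)
    have hB := (Complex.pos_iff.1 (posDef_gram H b.linearIndependent).det_pos)
    change Real.log (Matrix.of fun i j => K.inner (b i) (b j)).det.re = _
    rw [h1, Complex.mul_re, ← hA.2, mul_zero, sub_zero, Real.log_mul hB.1.ne' hA.1.ne']
    rfl
  rw [mul_dingMetric b hk hγ, dingQuantized, ← hμ, hdet]
  rw [Fintype.card_fin] at hle
  have h3 := mul_le_mul_of_nonneg_left hle (one_div_pos.2 (mul_pos hk' hN)).le
  have h4 : 1 / (k * dimSections n X k : ℝ) * (dimSections n X k * Real.log (μ.real univ))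
      = 1 / k * Real.log (μ.real univ) := by field_simp
  have h5 : (1 + γ / k) / γ * Real.log (μ.real univ)
      = 1 / γ * Real.log (μ.real univ) + 1 / k * Real.log (μ.real univ) := by field_simp
  linarith

end Ding

/-! ### Plurisubharmonicity of `log ‖f‖²` -/

section Levi

open Filter Topology

variable {n : ℕ}

lemma leviForm_congr {u w : Model n → ℝ} {z : Model n} (h : u =ᶠ[𝓝 z] w) (v : Model n) :
    leviForm u z v = leviForm w z v := by
  simp only [leviForm, h.fderiv.fderiv_eq]

lemma leviForm_affine {u w : Model n → ℝ} {z : Model n} (hu : ContDiffAt ℝ 2 u z)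
    (hw : ContDiffAt ℝ 2 w z) (a b c : ℝ) (v : Model n) :
    leviForm (fun x => a * u x + b * w x + c) z v = a * leviForm u z v + b * leviForm w z v := by
  have hd : ∀ {f : Model n → ℝ}, ContDiffAt ℝ 2 f z → DifferentiableAt ℝ (fderiv ℝ f) z :=
    fun hf => (hf.fderiv_right (m := 1) (by norm_num)).differentiableAt (by norm_num)
  have h1 : fderiv ℝ (fun x => a * u x + b * w x + c)
      =ᶠ[𝓝 z] fun x => a • fderiv ℝ u x + b • fderiv ℝ w x := by
    filter_upwards [hu.eventually (by simp), hw.eventually (by simp)] with x hx hx'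
    have hx := (hx.differentiableAt (by norm_num)).hasFDerivAt
    have hx' := (hx'.differentiableAt (by norm_num)).hasFDerivAt
    exact (((hx.const_mul a).add (hx'.const_mul b)).add_const c).fderiv
  have h2 : fderiv ℝ (fderiv ℝ fun x => a * u x + b * w x + c) z
      = a • fderiv ℝ (fderiv ℝ u) z + b • fderiv ℝ (fderiv ℝ w) z := by
    rw [h1.fderiv_eq]
    exact (((hd hu).hasFDerivAt.const_smul a).add ((hd hw).hasFDerivAt.const_smul b)).fderiv
  simp only [leviForm, h2, add_apply, smul_apply,
    smul_eq_mul]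
  ring

variable {W : Type*} [NormedAddCommGroup W] [InnerProductSpace ℂ W]

lemma contDiffAt_log_norm_sq {f : Model n → W} {z : Model n} (hf : ContDiffAt ℂ ω f z)
    (h0 : f z ≠ 0) : ContDiffAt ℝ ω (fun w => Real.log (‖f w‖ ^ 2)) z := by
  let : InnerProductSpace ℝ W := InnerProductSpace.complexToReal
  exact ((hf.restrict_scalars ℝ).norm_sq ℝ).log (by simpa using h0)

/-- The real Hessian of `log ‖f‖²` on the diagonal, for `f` holomorphic. -/
lemma fderiv_fderiv_log_norm_sq {f : Model n → W} {z : Model n} (hf : ContDiffAt ℂ ω f z)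
    (h0 : f z ≠ 0) (v : Model n) :
    fderiv ℝ (fderiv ℝ fun w => Real.log (‖f w‖ ^ 2)) z v v
      = (2 * ((inner ℂ (f z) (fderiv ℂ (fderiv ℂ f) z v v)).re + ‖fderiv ℂ f z v‖ ^ 2) * ‖f z‖ ^ 2
        - (2 * (inner ℂ (f z) (fderiv ℂ f z v)).re) ^ 2) / (‖f z‖ ^ 2) ^ 2 := by
  let : InnerProductSpace ℝ W := InnerProductSpace.complexToReal
  have hre : ∀ x y : W, (inner ℂ x y).re = inner ℝ x y := fun _ _ => rfl
  simp only [hre]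
  set u : Model n → ℝ := fun w => Real.log (‖f w‖ ^ 2) with hu
  have hline : HasDerivAt (fun t : ℝ => z + t • v) v 0 := by
    simpa using ((hasDerivAt_id (0 : ℝ)).smul_const v).const_add z
  have hlim : Tendsto (fun t : ℝ => z + t • v) (𝓝 0) (𝓝 z) := by
    simpa using hline.continuousAt.tendsto
  have hev : ∀ᶠ w in 𝓝 z, fderiv ℝ u w v
      = 2 * inner ℝ (f w) (fderiv ℂ f w v) / ‖f w‖ ^ 2 := by
    filter_upwards [hf.eventually (by simp), hf.continuousAt.eventually_ne h0] with w hw hw0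
    have h1 := (hw.differentiableAt (by simp)).hasFDerivAt.restrictScalars ℝ
    have h2 := (h1.norm_sq.log (pow_ne_zero 2 (norm_ne_zero_iff.2 hw0))).fderiv
    rw [hu, h2]
    simp
    field_simp
  have hL : HasDerivAt (fun t : ℝ => fderiv ℝ u (z + t • v) v)
      (fderiv ℝ (fderiv ℝ u) z v v) 0 := by
    have h1 : DifferentiableAt ℝ (fderiv ℝ u) (z + (0 : ℝ) • v) := by
      rw [zero_smul, add_zero]
      exact ((contDiffAt_log_norm_sq hf h0).fderiv_right (m := 1) (by simp)).differentiableAt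
        (by simp)
    have h2 := h1.hasFDerivAt.comp_hasDerivAt (0 : ℝ) hline
    have h3 := h2.clm_apply (hasDerivAt_const (0 : ℝ) v)
    simpa using h3
  have hp : HasDerivAt (fun t : ℝ => f (z + t • v)) (fderiv ℂ f z v) 0 := by
    have h1 : HasFDerivAt f ((fderiv ℂ f z).restrictScalars ℝ) (z + (0 : ℝ) • v) := by
      rw [zero_smul, add_zero]
      exact (hf.differentiableAt (by simp)).hasFDerivAt.restrictScalars ℝ
    exact h1.comp_hasDerivAt (0 : ℝ) hline
  have hq : HasDerivAt (fun t : ℝ => fderiv ℂ f (z + t • v) v)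
      (fderiv ℂ (fderiv ℂ f) z v v) 0 := by
    have h0 : HasFDerivAt (fun w => fderiv ℂ f w v)
        ((ContinuousLinearMap.apply ℂ W v).comp (fderiv ℂ (fderiv ℂ f) z)) z :=
      (ContinuousLinearMap.apply ℂ W v).hasFDerivAt.comp z
        ((hf.fderiv_right (m := 1) (by simp)).differentiableAt (by simp)).hasFDerivAt
    have h1 : HasFDerivAt (fun w => fderiv ℂ f w v)
        (((ContinuousLinearMap.apply ℂ W v).comp (fderiv ℂ (fderiv ℂ f) z)).restrictScalars ℝ)
        (z + (0 : ℝ) • v) := by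
      rw [zero_smul, add_zero]
      exact h0.restrictScalars ℝ
    exact h1.comp_hasDerivAt (0 : ℝ) hline
  have hR := ((hp.inner ℝ hq).const_mul 2).div hp.norm_sq (by simpa using h0)
  refine (hL.congr_of_eventuallyEq ?_).unique hR |>.trans ?_
  · filter_upwards [hlim.eventually hev] with t ht
    exact ht.symm
  · simp only [zero_smul, add_zero, real_inner_self_eq_norm_sq]
    ring

/-- The logarithm of the squared norm of a holomorphic function is plurisubharmonic. -/
lemma leviForm_log_norm_sq_nonneg {f : Model n → W} {z : Model n} (hf : ContDiffAt ℂ ω f z)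
    (h0 : f z ≠ 0) (v : Model n) : 0 ≤ leviForm (fun w => Real.log (‖f w‖ ^ 2)) z v := by
  -- the second derivatives of `f` along `v` and `i v` cancel, which leaves
  -- `(‖q‖² ‖p‖² - |⟨p, q⟩|²) / ‖p‖⁴` with `p = f z` and `q = Df(z) v`
  have hI : fderiv ℂ (fderiv ℂ f) z (Complex.I • v) (Complex.I • v)
      = -fderiv ℂ (fderiv ℂ f) z v v := by
    simp [smul_smul]
  have hpos : 0 < ‖f z‖ ^ 2 := by positivity
  rw [leviForm, fderiv_fderiv_log_norm_sq hf h0, fderiv_fderiv_log_norm_sq hf h0, hI, map_smul,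
    inner_neg_right, norm_smul, Complex.norm_I, one_mul, ← add_div]
  set p := f z
  set q := fderiv ℂ f z v
  have h2 : (inner ℂ p (Complex.I • q)).re = -(inner ℂ p q).im := by
    rw [inner_smul_right]
    simp
  have hcs : (inner ℂ p q).re ^ 2 + (inner ℂ p q).im ^ 2 ≤ ‖p‖ ^ 2 * ‖q‖ ^ 2 := by
    have h := norm_inner_le_norm (𝕜 := ℂ) p q
    have h' := pow_le_pow_left₀ (norm_nonneg _) h 2
    rw [Complex.sq_norm, Complex.normSq_apply, mul_pow] at h'
    linarith
  refine div_nonneg (div_nonneg ?_ (by positivity)) (by norm_num)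
  rw [h2, Complex.neg_re]
  nlinarith

end Levi

/-! ### Positivity and continuity along segments -/

section Limit

open Filter Topology MeasureTheory Set

variable {n : ℕ} {X : Type*} [TopologicalSpace X] [ChartedSpace (Model n) X]
  [IsManifold 𝓘(ℂ, Model n) ω X] {k : ℕ}

/-- Fubini-Study metrics have semipositive curvature. -/
lemma leviForm_logSum_nonneg {ι : Type*} [Fintype ι] (hk : 1 ≤ k) {c : ℝ} (hc : 0 < c)
    {s : ι → Sections n X k} (hs : ∀ x, ∃ i, value (s i) x ≠ 0) (e : atlas (Model n) X)
    {z : Model n} (hz : z ∈ e.1.target) (v : Model n) :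
    0 ≤ leviForm (weightInChart (logSum k c s) e) z v := by
  set f : Model n → EuclideanSpace ℂ ι :=
    fun w => WithLp.toLp 2 fun i => localSection (s i) e (e.1.symm w) with hf
  have hnorm : ∀ w, ‖f w‖ ^ 2 = ∑ i, ‖localSection (s i) e (e.1.symm w)‖ ^ 2 := fun w => by
    rw [EuclideanSpace.norm_sq_eq]
  have hfz : ContDiffAt ℂ ω f z := by
    refine contDiffAt_euclidean.2 fun i => ?_
    exact (contDiffOn_localSection (s i) e).contDiffAt (e.1.open_target.mem_nhds hz)
  have h0 : f z ≠ 0 := by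
    intro h
    have := sum_sq_local_pos (e.1.map_target hz) (hs (e.1.symm z))
    rw [← hnorm, h] at this
    simp at this
  have hev : weightInChart (logSum k c s) e =ᶠ[𝓝 z] fun w =>
      (k : ℝ)⁻¹ * Real.log (‖f w‖ ^ 2) + 0 * Real.log (‖f w‖ ^ 2) + (k : ℝ)⁻¹ * Real.log c := by
    filter_upwards [e.1.open_target.mem_nhds hz] with w hw
    rw [weightInChart, localWeight_logSum hk hc (e.1.map_target hw) (hs _), hnorm]
    ring
  have hC := (contDiffAt_log_norm_sq hfz h0).of_le (show (2 : WithTop ℕ∞) ≤ ω by simp)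
  rw [leviForm_congr hev, leviForm_affine hC hC, zero_mul, add_zero]
  exact mul_nonneg (by positivity) (leviForm_log_norm_sq_nonneg hfz h0 v)

lemma IsPositiveMetric.combo {ψ φ : X → ℝ} (hψ : IsPositiveMetric n ψ) (hφ : IsSmoothMetric n φ)
    (hsemi : ∀ e : atlas (Model n) X, ∀ z ∈ e.1.target, ∀ v, 0 ≤ leviForm (weightInChart φ e) z v)
    {a : ℝ} (h0 : 0 < a) (h1 : a ≤ 1) :
    IsPositiveMetric n fun x => a * ψ x + (1 - a) * φ x := by
  refine ⟨hψ.1.combo hφ a, fun e z hz v hv => ?_⟩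
  have hC : ∀ {χ : X → ℝ}, IsSmoothMetric n χ → ContDiffAt ℝ 2 (weightInChart χ e) z :=
    fun hχ => ((hχ e).contDiffAt (e.1.open_target.mem_nhds hz)).of_le
      (WithTop.coe_le_coe.2 (le_top (a := (2 : ℕ∞))))
  have heq : weightInChart (fun x => a * ψ x + (1 - a) * φ x) e
      = fun w => a * weightInChart ψ e w + (1 - a) * weightInChart φ e w + 0 := by
    ext w
    rw [weightInChart_combo, add_zero]
  rw [heq, leviForm_affine (hC hψ.1) (hC hφ)]
  exact add_pos_of_pos_of_nonneg (mul_pos h0 (hψ.2 e z hz v hv))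
    (mul_nonneg (sub_nonneg.2 h1) (hsemi e z hz v))

variable [MeasurableSpace X] [BorelSpace X] [CompactSpace X] [Nonempty X]

/-- The Ding functional is continuous along affine segments of metrics. -/
lemma continuousAt_dingMetric
    (b : Module.Basis (Fin (dimSections n X k)) ℂ (Sections n X k)) (γ : ℝ) {φ φ₀ h : X → ℝ}
    (hφ : IsSmoothMetric n φ) (hφ₀ : IsSmoothMetric n φ₀) (hh : Continuous h) :
    ContinuousAt (fun t : ℝ => dingMetric b γ φ₀ fun x => φ x + t * h x) 0 := by
  have := isFiniteMeasure_twistedVol hφ hφ₀ γ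
  have := isOpenPosMeasure_twistedVol hφ hφ₀ γ
  have := neZero_of_isOpenPosMeasure (twistedVol n γ φ₀ φ)
  have hth : ∀ t : ℝ, Continuous fun x => t * h x := fun t => continuous_const.mul hh
  have hvol : Continuous fun t : ℝ => (twistedVol n γ φ₀ fun x => φ x + t * h x).real univ := by
    simp only [fun t => twistedVol_real_univ_add hφ hφ₀ (hth t) γ]
    have := continuous_parametric_integral_of_continuous (μ := twistedVol n γ φ₀ φ)
      (f := fun (t : ℝ) x => Real.exp (-(γ * (t * h x)))) (by fun_prop) isCompact_univ
    simpa using this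
  have hform : ∀ s t : Sections n X k, Continuous fun r : ℝ =>
      hilbForm k (fun x => φ x + r * h x) (twistedVol n γ φ₀ fun x => φ x + r * h x) s t := by
    intro s t
    simp only [hilbForm, fun r F => integral_twistedVol_add (E := ℂ) hφ hφ₀ (hth r) γ F]
    have hpair := continuous_pairing hφ s t
    have hF : Continuous (Function.uncurry fun (r : ℝ) x => Real.exp (-(γ * (r * h x))) •
        (((starRingEnd ℂ (value s x) * value t x) * (Real.exp (-(k * φ x)) : ℂ))
          * (Real.exp (-(k * (r * h x))) : ℂ))) := by
      have h1 : Continuous fun p : ℝ × X => Real.exp (-(γ * (p.1 * h p.2))) := by fun_prop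
      have h2 : Continuous fun p : ℝ × X => (Real.exp (-(k * (p.1 * h p.2))) : ℂ) := by fun_prop
      exact h1.smul ((hpair.comp (continuous_snd (X := ℝ) (Y := X))).mul h2)
    have := continuous_parametric_integral_of_continuous (μ := twistedVol n γ φ₀ φ)
      hF isCompact_univ
    simp only [Measure.restrict_univ] at this
    refine this.congr fun r => integral_congr_ae (.of_forall fun x => ?_)
    simp only [mul_add, neg_add, Real.exp_add, Complex.ofReal_mul, mul_assoc]
  have hdet : Continuous fun r : ℝ => (Matrix.det (Matrix.of fun i j => hilbForm k
      (fun x => φ x + r * h x) (twistedVol n γ φ₀ fun x => φ x + r * h x) (b i) (b j))).re :=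
    Complex.continuous_re.comp (Continuous.matrix_det
      (continuous_matrix fun i j => hform (b i) (b j)))
  unfold dingMetric calL logDet
  refine ContinuousAt.sub (ContinuousAt.neg (ContinuousAt.mul continuousAt_const
    (hdet.continuousAt.log ?_))) (ContinuousAt.mul continuousAt_const
    (hvol.continuousAt.log ?_))
  · simp only [zero_mul, add_zero]
    exact (det_re_pos (posDef_gram (hilbCore hφ (twistedVol n γ φ₀ φ)) b.linearIndependent)).ne'
  · simp only [zero_mul, add_zero]
    exact measureReal_univ_ne_zero

end Limit

end AntiCanonical

open AntiCanonical in
theorem proposition3p1 {n : ℕ} {X : Type*} [TopologicalSpace X] [T2Space X] [CompactSpace X]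
    [Nonempty X] [ChartedSpace (AntiCanonical.Model n) X]
    [IsManifold 𝓘(ℂ, AntiCanonical.Model n) ω X] [MeasurableSpace X] [BorelSpace X]
    (k : ℕ) (hk : 1 ≤ k) (hgg : AntiCanonical.GloballyGenerated n X k)
    (γ : ℝ) (hγ : 0 < γ)
    (ψ₀ : X → ℝ) (hψ₀ : AntiCanonical.IsPositiveMetric n ψ₀)
    (b : Module.Basis (Fin (AntiCanonical.dimSections n X k)) ℂ (AntiCanonical.Sections n X k))
    (hb : ∀ i j, AntiCanonical.hilbForm k ψ₀ (AntiCanonical.volForm n ψ₀) (b i) (b j)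
      = if i = j then 1 else 0)
    (φ₀ : X → ℝ) (hφ₀ : AntiCanonical.IsSmoothMetric n φ₀) :
    (∀ φ : X → ℝ, AntiCanonical.IsSmoothMetric n φ →
      ∃ H : AntiCanonical.HermMetric n X k,
        (∀ s t, H.inner s t
          = AntiCanonical.hilbForm k φ (AntiCanonical.twistedVol n γ φ₀ φ) s t) ∧
        AntiCanonical.dingQuantized b γ φ₀ H
          ≤ (1 + γ / k) * AntiCanonical.dingMetric b γ φ₀ φ) ∧
    (∀ H : AntiCanonical.HermMetric n X k,
      AntiCanonical.IsSmoothMetric n (AntiCanonical.fubiniStudy H) ∧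
      (1 + γ / k) * AntiCanonical.dingMetric b γ φ₀ (AntiCanonical.fubiniStudy H)
        ≤ AntiCanonical.dingQuantized b γ φ₀ H) ∧
    (⨅ H : AntiCanonical.HermMetric n X k, (AntiCanonical.dingQuantized b γ φ₀ H : EReal))
      = ((1 + γ / k : ℝ) : EReal) *
        ⨅ φ : {φ : X → ℝ // AntiCanonical.IsPositiveMetric n φ},
          (AntiCanonical.dingMetric b γ φ₀ φ.1 : EReal) := by
  -- `dimSections` is a `finrank`; a basis with that many elements excludes its junk value
  have : FiniteDimensional ℂ (Sections n X k) := b.finiteDimensional_of_finite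
  have hfirst : ∀ φ : X → ℝ, IsSmoothMetric n φ →
      ∃ H : HermMetric n X k,
        (∀ s t, H.inner s t = hilbForm k φ (twistedVol n γ φ₀ φ) s t) ∧
        dingQuantized b γ φ₀ H ≤ (1 + γ / k) * dingMetric b γ φ₀ φ := by
    intro φ hφ
    have := isFiniteMeasure_twistedVol hφ hφ₀ γ
    have := isOpenPosMeasure_twistedVol hφ hφ₀ γ
    let H := hilbCore (k := k) hφ (twistedVol n γ φ₀ φ)
    exact ⟨H, fun s t => rfl, dingQuantized_le b hk hgg hγ hφ hφ₀ fun s t => rfl⟩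
  have hc : (0 : ℝ) < 1 + γ / k := by positivity
  have hc' : (0 : EReal) < ((1 + γ / k : ℝ) : EReal) := EReal.coe_pos.2 hc
  refine ⟨hfirst, fun H => ⟨isSmoothMetric_fubiniStudy hk hgg H,
    dingMetric_fubiniStudy_le b hk hgg hγ hφ₀ H⟩, ?_⟩
  apply le_antisymm
  · rw [← EReal.div_le_iff_le_mul hc' (EReal.coe_ne_top _)]
    refine le_iInf fun φ => ?_
    rw [EReal.div_le_iff_le_mul hc' (EReal.coe_ne_top _)]
    obtain ⟨H, -, hH⟩ := hfirst φ.1 φ.2.1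
    refine (iInf_le _ H).trans ?_
    exact_mod_cast hH
  · refine le_iInf fun H => ?_
    have hFS := isSmoothMetric_fubiniStudy hk hgg H
    have hcont := continuousAt_dingMetric b γ hFS hφ₀
      (continuous_sub_of_smooth hψ₀.1 hFS)
    have hlim : Filter.Tendsto (fun t : ℝ => (((1 + γ / k) * dingMetric b γ φ₀
        fun x => fubiniStudy H x + t * (ψ₀ x - fubiniStudy H x) : ℝ)
          : EReal)) (nhdsWithin 0 (Set.Ioi 0))
        (nhds (((1 + γ / k) * dingMetric b γ φ₀ (fubiniStudy H) : ℝ)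
          : EReal)) := by
      have h := (continuous_coe_real_ereal.continuousAt.comp
        (hcont.const_mul (1 + γ / k))).tendsto
      simp only [Function.comp_def, zero_mul, add_zero] at h
      exact h.mono_left nhdsWithin_le_nhds
    refine (ge_of_tendsto hlim ?_).trans
      (EReal.coe_le_coe_iff.2 (dingMetric_fubiniStudy_le b hk hgg hγ hφ₀ H))
    -- the segment from `FS(H)` to `ψ₀` lies in `𝓗` except for its starting point
    filter_upwards [Ioc_mem_nhdsGT one_pos] with t ht
    have hpos : IsPositiveMetric n fun x => fubiniStudy H x
        + t * (ψ₀ x - fubiniStudy H x) := by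
      convert hψ₀.combo hFS (fun e z hz v => leviForm_logSum_nonneg hk
        (inv_pos.2 (Nat.cast_pos.2 (dimSections_pos hgg)))
        (exists_value_ne_zero hgg H) e hz v) ht.1 ht.2 using 2
      ring
    rw [EReal.coe_mul]
    exact mul_le_mul_of_nonneg_left (iInf_le (fun φ : {φ : X → ℝ // IsPositiveMetric n φ} =>
      (dingMetric b γ φ₀ φ.1 : EReal)) ⟨_, hpos⟩) hc'.le
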